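/- Let $A\in\mathbb R^{n\times n}$, $B\in\mathbb R^{n\times m}$ be a controllable pair and let $\tilde n$ be the least natural number with $\operatorname{rank}[B,AB,\dots,A^{\tilde n-1}B]=n$. Let $\mu\in[-1,1/\tilde n]$, $\rho>0$, let $G_0\in\mathbb R^{n\times n}$, $Y_0\in\mathbb R^{m\times n}$ satisfy $$AG_0-G_0A+BY_0=A,\qquad G_0B=0,$$ put $G_{\mathbf d}=I_n+\mu G_0$, $K_0=Y_0(G_0-I_n)^{-1}$, $A_0=A+BK_0$, and let $X=X^\top\succ0$, $Y\in\mathbb R^{m\times n}$ satisfy $$A_0X+XA_0^\top+BY+Y^\top B^\top+\rho(G_{\mathbf d}X+XG_{\mathbf d}^\top)=0,\qquad G_{\mathbf d}X+XG_{\mathbf d}^\top\succ0 .$$ Put $P=X^{-1}$, $K=YX^{-1}$, $\mathbf d(s)=e^{sG_{\mathbf d}}$, and let $\|\cdot\|_{\mathbf d}$ be the canonical homogeneous norm: $\|0\|_{\mathbf d}=0$ and, for $x\ne0$, $\|x\|_{\mathbf d}=e^{s}$, where $s$ is the real number with $z^\top Pz=1$ for $z=\mathbf d(-s)x$. Let $$u(x)=K_0x+\|x\|_{\mathbf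 d}^{1+\mu}K\,\mathbf d(-\ln\|x\|_{\mathbf d})x\quad(x\neq0),\qquad u(0)=0 .$$ Let $\Pi\in\mathbb R^{n\times n}$ and let $\Omega\subset\mathbb R^n$ be a closed set with $\Pi\Omega\cap\Omega=\emptyset$, such that (a) $\mathbf d(-\ln\|x\|_{\mathbf d})\Pi x=\Pi\,\mathbf d(-\ln\|x\|_{\mathbf d})x$ for all $x\in\Omega$; (b) $y^\top\Pi^\top P\Pi y\le1$ for every $y$ of the form $y=\mathbf d(-\ln\|x\|_{\mathbf d})x$ with $x\in\Omega$ (these $y$ satisfy $y^\top Py=1$). Consider the closed-loop impulsive system $$\dot x=Ax+Bu(x)\ \text{ if } x^-\notin\Omega,\qquad x=\Pi x^-\ \text{ if } x^-\in\Omega,$$ where $x^-(t)$ is the left limit of $x$ at $t$. A solution on $[0,T)$, $0<T\le\infty$, with initial state $x_0$ is a right-continuous function with left limits at all $t\in(0,T)$, that satisfies $x(t)=\Pi x^-(t)$ if $x^-(t)\in\Omega$ and $x(t)=x^-(t)$ otherwise for $t\in(0,T)$, satisfies $\dot x=Ax+Bu(x)$ in the integral (Carathéodory) sense on every interval without resets,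 and starts at $x(0)=x_0$ or, if $x_0\in\Omega$, possibly at $x(0)=\Pi x_0$. Then for every $x_0\in\mathbb R^n$ there is a solution on $[0,\infty)$, every solution extends to a solution on $[0,\infty)$, and every solution $x$ with initial state $x_0$ has the following properties at all times of its interval of definition. * If $\mu<0$, the system is globally uniformly finite-time stable (Lyapunov stable, and solutions vanish after a settling time that depends only on $x_0$ and is bounded on bounded sets), and $x(t)=0$ for all $t\ge\|x_0\|_{\mathbf d}^{-\mu}/(-\rho\mu)$. * If $\mu=0$, the system is globally uniformly exponentially stable ($\|x(t)\|\le Ce^{-ct}\|x_0\|$ with constants $C,c>0$ independent of the solution), and $\|x(t)\|_{\mathbf d}\le e^{-\rho t}\|x_0\|_{\mathbf d}$ for all $t\ge0$. * If $\mu>0$, the system is globally uniformly nearly fixed-time stable (Lyapunov stable, and for every $r>0$ there is $T_r>0$, independent of $x_0$, with $\|x(t)\|<r$ for all $t\ge T_r$), and for every $r>0$, $\|x(t)\|_{\mathbf d}\le r$ for all $t\ge 1/(\rho\mu r^{\mu})$. -/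

import Mathlib

open Set Filter Topology MeasureTheory Matrix

noncomputable section

namespace HomImpulsive

/-- The state space `ℝⁿ` as column vectors. Norms are written out explicitly below, so that the
sup norm that Lean puts on this type plays no role beyond its (standard) topology. -/
abbrev Vec (n : ℕ) := Fin n → ℝ

/-- Real `n × m` matrices. -/
abbrev Mat (n m : ℕ) := Matrix (Fin n) (Fin m) ℝ

/-- The weighted Euclidean norm `√(xᵀ P x)`. -/
def wnorm {n : ℕ} (P : Mat n n) (x : Vec n) : ℝ := √(x ⬝ᵥ (P *ᵥ x))

/-- The Euclidean norm `√(xᵀ x)`. -/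
def enorm₂ {n : ℕ} (x : Vec n) : ℝ := √(x ⬝ᵥ x)

/-! ### Dilations and the canonical homogeneous norm -/

/-- The linear dilation `d(s) = e^{sG}` generated by `G`. -/
def dil {n : ℕ} (G : Mat n n) (s : ℝ) : Mat n n := NormedSpace.exp (s • G)

open Classical in
/-- The canonical homogeneous norm of the dilation generated by `G` and the norm `√(xᵀ P x)`:
`0` at the origin, and `e^s` with `s` such that `‖d(-s) x‖_P = 1` elsewhere. -/
def homNorm {n : ℕ} (G P : Mat n n) (x : Vec n) : ℝ :=
  if x = 0 then 0 else Real.exp (Classical.epsilon fun s : ℝ => wnorm P (dil G (-s) *ᵥ x) = 1)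

/-- The projection `d(-ln ‖x‖_d) x` of `x` to the unit sphere along the dilation. -/
def homProj {n : ℕ} (G P : Mat n n) (x : Vec n) : Vec n :=
  dil G (-Real.log (homNorm G P x)) *ᵥ x

/-! ### Controllability -/

/-- The block matrix `[B, AB, …, A^{k-1} B]`. -/
def ctrbMatrix {n m : ℕ} (A : Mat n n) (B : Mat n m) (k : ℕ) :
    Matrix (Fin n) (Fin k × Fin m) ℝ :=
  Matrix.of fun i p => (A ^ (p.1 : ℕ) * B) i p.2

/-- Kalman rank condition. -/
def Controllable {n m : ℕ} (A : Mat n n) (B : Mat n m) : Prop := (ctrbMatrix A B n).rank = n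

/-- The least `k` such that `rank [B, AB, …, A^{k-1} B] = n`. -/
def ctrbIndex {n m : ℕ} (A : Mat n n) (B : Mat n m) : ℕ := sInf {k : ℕ | (ctrbMatrix A B k).rank = n}

/-! ### The homogeneous controller -/

/-- `G_d = I + μ G₀`. -/
def genD {n : ℕ} (μ : ℝ) (G₀ : Mat n n) : Mat n n := 1 + μ • G₀

/-- `K₀ = Y₀ (G₀ - I)⁻¹`. -/
def gainK₀ {n m : ℕ} (G₀ : Mat n n) (Y₀ : Mat m n) : Mat m n := Y₀ * (G₀ - 1)⁻¹

/-- `A₀ = A + B Y₀ (G₀ - I)⁻¹`. -/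
def matA₀ {n m : ℕ} (A : Mat n n) (B : Mat n m) (G₀ : Mat n n) (Y₀ : Mat m n) : Mat n n :=
  A + B * gainK₀ G₀ Y₀

/-- The data `G₀, Y₀, X, Y` of a homogeneous controller of degree `μ` with decay parameter `ρ`
for the pair `(A, B)`. -/
structure IsDesign {n m : ℕ} (A : Mat n n) (B : Mat n m) (μ ρ : ℝ)
    (G₀ : Mat n n) (Y₀ : Mat m n) (X : Mat n n) (Y : Mat m n) : Prop where
  controllable : Controllable A B
  degree : μ ∈ Icc (-1 : ℝ) (1 / (ctrbIndex A B : ℝ))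
  rho_pos : 0 < ρ
  sylvester : A * G₀ - G₀ * A + B * Y₀ = A
  generator_mul_B : G₀ * B = 0
  posDef : X.PosDef
  monotone : (genD μ G₀ * X + X * (genD μ G₀)ᵀ).PosDef
  lmi : matA₀ A B G₀ Y₀ * X + X * (matA₀ A B G₀ Y₀)ᵀ + B * Y + Yᵀ * Bᵀ
    + ρ • (genD μ G₀ * X + X * (genD μ G₀)ᵀ) = 0

/-- The feedback `u(x) = K₀ x + ‖x‖_d^{1+μ} K d(-ln ‖x‖_d) x` with `P = X⁻¹`, `K = Y X⁻¹`.
At the origin its value is `0`. -/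
def feedback {n m : ℕ} (μ : ℝ) (G₀ : Mat n n) (Y₀ : Mat m n) (X : Mat n n) (Y : Mat m n)
    (x : Vec n) : Vec m :=
  gainK₀ G₀ Y₀ *ᵥ x
    + (homNorm (genD μ G₀) X⁻¹ x) ^ (1 + μ) • ((Y * X⁻¹) *ᵥ homProj (genD μ G₀) X⁻¹ x)

/-- The closed-loop vector field `A x + B u(x)`. -/
def closedLoop {n m : ℕ} (A : Mat n n) (B : Mat n m) (μ : ℝ) (G₀ : Mat n n) (Y₀ : Mat m n)
    (X : Mat n n) (Y : Mat m n) (x : Vec n) : Vec n :=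
  A *ᵥ x + B *ᵥ feedback μ G₀ Y₀ X Y x

/-! ### Impulsive systems -/

/-- `z` is the left limit `x⁻` of `x` at time `t`. -/
def IsLeftLimit {n : ℕ} (x : ℝ → Vec n) (t : ℝ) (z : Vec n) : Prop := Tendsto x (𝓝[<] t) (𝓝 z)

/-- `x` solves the impulsive system `ẋ = f(x)` for `x⁻ ∉ Ω`, `x = R x⁻` for `x⁻ ∈ Ω` on the time
interval `[0, T)` (`T = ⊤` is allowed) with initial state `x₀`: it is right-continuous with left
limits, is reset exactly when its left limit lies in `Ω`, and is a Carathéodory solution of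
`ẋ = f(x)` on every interval without resets. A trajectory issued from a point of `Ω` may be reset
at the initial time (that is, `x₀` may be read as `x(0)` or as `x⁻(0)`). -/
structure IsSolution {n : ℕ} (f : Vec n → Vec n) (R : Mat n n) (Ω : Set (Vec n))
    (x₀ : Vec n) (T : EReal) (x : ℝ → Vec n) : Prop where
  pos : 0 < T
  init : x 0 = x₀ ∨ (x₀ ∈ Ω ∧ x 0 = R *ᵥ x₀)
  rightCont : ∀ t : ℝ, 0 ≤ t → (t : EReal) < T → ContinuousWithinAt x (Ici t) t
  jump : ∀ t : ℝ, 0 < t → (t : EReal) < T →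
    ∃ z, IsLeftLimit x t z ∧ (z ∈ Ω → x t = R *ᵥ z) ∧ (z ∉ Ω → x t = z)
  flow : ∀ a b : ℝ, 0 ≤ a → a ≤ b → (b : EReal) < T →
    (∀ t ∈ Ioc a b, ∀ z, IsLeftLimit x t z → z ∉ Ω) →
    IntervalIntegrable (fun τ => f (x τ)) volume a b ∧ x b = x a + ∫ τ in a..b, f (x τ)

/-- Every initial state admits a solution on `[0, ∞)`, and every solution extends to such a one. -/
def ForwardComplete {n : ℕ} (f : Vec n → Vec n) (R : Mat n n) (Ω : Set (Vec n)) : Prop :=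
  (∀ x₀, ∃ x, IsSolution f R Ω x₀ ⊤ x) ∧
  ∀ x₀ T x, IsSolution f R Ω x₀ T x →
    ∃ y, IsSolution f R Ω x₀ ⊤ y ∧ ∀ t : ℝ, 0 ≤ t → (t : EReal) < T → y t = x t

def LyapunovStable {n : ℕ} (f : Vec n → Vec n) (R : Mat n n) (Ω : Set (Vec n)) : Prop :=
  ∀ ε > 0, ∃ δ > 0, ∀ x₀ T x, IsSolution f R Ω x₀ T x → enorm₂ x₀ < δ →
    ∀ t : ℝ, 0 ≤ t → (t : EReal) < T → enorm₂ (x t) < ε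

/-- Global uniform finite-time stability: Lyapunov stability, and every solution vanishes after a
settling time that depends only on the initial state and is bounded on bounded sets. -/
def FiniteTimeStable {n : ℕ} (f : Vec n → Vec n) (R : Mat n n) (Ω : Set (Vec n)) : Prop :=
  LyapunovStable f R Ω ∧
  ∃ S : Vec n → ℝ, (∀ r : ℝ, BddAbove (S '' {x₀ | enorm₂ x₀ ≤ r})) ∧
    ∀ x₀ T x, IsSolution f R Ω x₀ T x →
      ∀ t : ℝ, 0 ≤ t → S x₀ ≤ t → (t : EReal) < T → x t = 0

/-- Global uniform exponential stability. -/
def ExponentiallyStable {n : ℕ} (f : Vec n → Vec n) (R : Mat n n) (Ω : Set (Vec n)) : Prop :=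
  ∃ C > 0, ∃ c > 0, ∀ x₀ T x, IsSolution f R Ω x₀ T x →
    ∀ t : ℝ, 0 ≤ t → (t : EReal) < T → enorm₂ (x t) ≤ C * Real.exp (-c * t) * enorm₂ x₀

/-- Global uniform nearly fixed-time stability: Lyapunov stability, and every neighbourhood of the
origin is reached, for good, within a time that does not depend on the initial state. -/
def NearlyFixedTimeStable {n : ℕ} (f : Vec n → Vec n) (R : Mat n n) (Ω : Set (Vec n)) : Prop :=
  LyapunovStable f R Ω ∧
  ∀ r > 0, ∃ S > 0, ∀ x₀ T x, IsSolution f R Ω x₀ T x →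
    ∀ t : ℝ, S ≤ t → (t : EReal) < T → enorm₂ (x t) < r

end HomImpulsive

end

/-! In homogeneous coordinates the closed loop is linear. Controllability makes `G₀ - I` invertible,
so `A₀` is well behaved: `A₀(G₀ - I) = G₀A₀`. Together with `G₀B = 0` this gives `f(d(s)y) = e^{μs}
d(s)Hy` for `yᵀPy = 1`, where `H = A₀ + BK`, while the matrix equation for `X` becomes `PH + HᵀP =
-ρ(PG + GᵀP)` with `G = G_d`. These facts are packaged as `IsHomField`. Along the flow away from the
origin, `σ = ln ‖x‖_d` then satisfies `σ' = -ρe^{μσ}` exactly, and by (a) and (b) a reset never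
increases `σ` (`homNorm_mulVec_le`). The three sign cases of `μ` are the three shapes of the
solutions of this scalar equation.

The decay is proved by comparison, without differentiating the homogeneous norm. By
`homNorm_le_exp_iff`, `‖x‖_d ≤ e^s` is the quadratic inequality `q(d(-s)x) ≤ 1`, `q` being the form
of `P`; `homNorm_le_exp_of_supersolution` propagates it along flow and jumps with `s = σ(t)` for any
strict supersolution `σ`. Such `σ` come from explicit scalar solutions with `ρ` replaced by some `k
< ρ`.

For completeness, the bound on `‖x‖_d` bounds both the state and the velocity. The compact set `Π(Ω
∩ ball)` lies at positive distance from `Ω`, so resets are separated by a dwell time, a left limit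
exists at any finite end time, and the solution can be restarted there; Zorn's lemma concludes.
Local existence is explicit: `H + ρG` generates a flow preserving the `P`-sphere, which is
transported by the dilation. -/

noncomputable section

namespace HomImpulsive

/-! ### Quadratic forms -/

/-- The quadratic form `xᵀ P x`. -/
def qform {n : ℕ} (P : Mat n n) (x : Vec n) : ℝ := x ⬝ᵥ (P *ᵥ x)

section QuadraticForms

variable {n : ℕ}

theorem qform_smul (P : Mat n n) (c : ℝ) (x : Vec n) : qform P (c • x) = c ^ 2 * qform P x := by
  simp only [qform, mulVec_smul, dotProduct_smul, smul_dotProduct, smul_eq_mul]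
  ring

theorem qform_zero (P : Mat n n) : qform P (0 : Vec n) = 0 := by simp [qform]

theorem continuous_qform (P : Mat n n) : Continuous (qform P) := by
  unfold qform dotProduct mulVec dotProduct
  fun_prop

theorem qform_pos {P : Mat n n} (hP : P.PosDef) {x : Vec n} (hx : x ≠ 0) : 0 < qform P x := by
  simpa [qform] using hP.dotProduct_mulVec_pos hx

theorem qform_eq_norm_sq_mul (P : Mat n n) {x : Vec n} (hx : x ≠ 0) :
    qform P x = ‖x‖ ^ 2 * qform P (‖x‖⁻¹ • x) := by
  rw [qform_smul, ← mul_assoc, ← mul_pow, mul_inv_cancel₀ (norm_ne_zero_iff.2 hx)]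
  simp

theorem norm_inv_smul_mem_sphere {x : Vec n} (hx : x ≠ 0) :
    ‖x‖⁻¹ • x ∈ Metric.sphere (0 : Vec n) 1 := by
  simp [norm_smul, inv_mul_cancel₀ (norm_ne_zero_iff.2 hx)]

theorem exists_mul_norm_sq_le_qform {P : Mat n n} (hP : P.PosDef) :
    ∃ c > 0, ∀ x, c * ‖x‖ ^ 2 ≤ qform P x := by
  -- The sphere is empty exactly when `n = 0`; otherwise the constant is the minimum of the form on
  -- it.
  rcases (Metric.sphere (0 : Vec n) 1).eq_empty_or_nonempty with he | hne
  · refine ⟨1, one_pos, fun x => ?_⟩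
    rcases eq_or_ne x 0 with rfl | hx
    · simp [qform_zero]
    · exact absurd (norm_inv_smul_mem_sphere hx) (he ▸ notMem_empty _)
  · obtain ⟨z, hz, hmin⟩ := (isCompact_sphere (0 : Vec n) 1).exists_isMinOn hne
      (continuous_qform P).continuousOn
    have hz0 : z ≠ 0 := by rintro rfl; simp at hz
    refine ⟨qform P z, qform_pos hP hz0, fun x => ?_⟩
    rcases eq_or_ne x 0 with rfl | hx
    · simp [qform_zero]
    · rw [qform_eq_norm_sq_mul P hx, mul_comm]
      exact mul_le_mul_of_nonneg_left (hmin (norm_inv_smul_mem_sphere hx)) (sq_nonneg _)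

theorem exists_qform_le_mul_norm_sq (P : Mat n n) :
    ∃ C > 0, ∀ x, qform P x ≤ C * ‖x‖ ^ 2 := by
  obtain ⟨C, hC⟩ := (isCompact_sphere (0 : Vec n) 1).bddAbove_image
    (continuous_qform P).continuousOn
  refine ⟨max C 1, by positivity, fun x => ?_⟩
  rcases eq_or_ne x 0 with rfl | hx
  · simp [qform_zero]
  · rw [qform_eq_norm_sq_mul P hx, mul_comm]
    refine mul_le_mul_of_nonneg_right (le_trans ?_ (le_max_left _ _)) (sq_nonneg _)
    exact hC (mem_image_of_mem _ (norm_inv_smul_mem_sphere hx))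

/-- Any quadratic form is dominated by a multiple of a positive definite one. -/
theorem exists_qform_le_mul_qform {P : Mat n n} (hP : P.PosDef) (S : Mat n n) :
    ∃ C > 0, ∀ x, qform S x ≤ C * qform P x := by
  obtain ⟨c, hc, h1⟩ := exists_mul_norm_sq_le_qform hP
  obtain ⟨C, hC, h2⟩ := exists_qform_le_mul_norm_sq S
  refine ⟨C / c, by positivity, fun x => (h2 x).trans ?_⟩
  rw [div_mul_eq_mul_div, le_div_iff₀ hc]
  nlinarith [h1 x]

theorem wnorm_eq_sqrt_qform (P : Mat n n) (x : Vec n) : wnorm P x = √(qform P x) := rfl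

theorem enorm₂_eq_sqrt_qform (x : Vec n) : enorm₂ x = √(qform 1 x) := by
  simp [enorm₂, qform]

theorem wnorm_eq_one_iff {P : Mat n n} {x : Vec n} : wnorm P x = 1 ↔ qform P x = 1 := by
  rw [wnorm_eq_sqrt_qform, Real.sqrt_eq_one]

theorem exists_enorm₂_le_mul_norm : ∃ C > 0, ∀ x : Vec n, enorm₂ x ≤ C * ‖x‖ := by
  obtain ⟨C, hC, h⟩ := exists_qform_le_mul_norm_sq (1 : Mat n n)
  refine ⟨√C, Real.sqrt_pos.2 hC, fun x => ?_⟩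
  rw [enorm₂_eq_sqrt_qform, ← Real.sqrt_sq (norm_nonneg x), ← Real.sqrt_mul hC.le]
  exact Real.sqrt_le_sqrt (by simpa using h x)

theorem exists_norm_le_mul_enorm₂ : ∃ C > 0, ∀ x : Vec n, ‖x‖ ≤ C * enorm₂ x := by
  obtain ⟨c, hc, h⟩ := exists_mul_norm_sq_le_qform (n := n) (P := 1) PosDef.one
  refine ⟨√(c⁻¹), Real.sqrt_pos.2 (inv_pos.2 hc), fun x => ?_⟩
  rw [enorm₂_eq_sqrt_qform, ← Real.sqrt_mul (inv_pos.2 hc).le]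
  refine Real.le_sqrt_of_sq_le ?_
  rw [inv_mul_eq_div, le_div_iff₀ hc, mul_comm]
  exact h x

theorem hasDerivWithinAt_qform {P : Mat n n} {y : ℝ → Vec n} {y' : Vec n} {s : Set ℝ} {t : ℝ}
    (hy : HasDerivWithinAt y y' s t) :
    HasDerivWithinAt (fun τ => qform P (y τ)) (y' ⬝ᵥ (P *ᵥ y t) + y t ⬝ᵥ (P *ᵥ y')) s t := by
  have h := hasDerivWithinAt_pi.1 hy
  unfold qform dotProduct mulVec dotProduct
  rw [← Finset.sum_add_distrib]
  exact HasDerivWithinAt.fun_sum fun i _ =>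
    (h i).mul (HasDerivWithinAt.fun_sum fun j _ => (h j).const_mul (P i j))

/-- The left side is the derivative of `xᵀPx` along `x' = Mx`. -/
theorem dotProduct_mulVec_add_eq_qform {P : Mat n n} (M : Mat n n) (x : Vec n) :
    (M *ᵥ x) ⬝ᵥ (P *ᵥ x) + x ⬝ᵥ (P *ᵥ (M *ᵥ x)) = qform (P * M + Mᵀ * P) x := by
  simp only [qform, add_mulVec, dotProduct_add, ← mulVec_mulVec]
  rw [dotProduct_mulVec x Mᵀ, vecMul_transpose, add_comm]

end QuadraticForms

/-! ### Linear dilations -/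

section Dilations

variable {n : ℕ}

theorem dil_zero (G : Mat n n) : dil G 0 = 1 := by simp [dil]

theorem dil_add (G : Mat n n) (s t : ℝ) : dil G (s + t) = dil G s * dil G t := by
  unfold dil
  rw [add_smul, Matrix.exp_add_of_commute]
  exact ((Commute.refl G).smul_left s).smul_right t

theorem dil_mulVec_dil_neg_mulVec (G : Mat n n) (s : ℝ) (x : Vec n) :
    dil G s *ᵥ (dil G (-s) *ᵥ x) = x := by
  rw [mulVec_mulVec, ← dil_add, add_neg_cancel, dil_zero, one_mulVec]

theorem dil_neg_mulVec_dil_mulVec (G : Mat n n) (s : ℝ) (x : Vec n) :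
    dil G (-s) *ᵥ (dil G s *ᵥ x) = x := by
  rw [mulVec_mulVec, ← dil_add, neg_add_cancel, dil_zero, one_mulVec]

theorem dil_mulVec_ne_zero (G : Mat n n) (s : ℝ) {x : Vec n} (hx : x ≠ 0) :
    dil G s *ᵥ x ≠ 0 := by
  intro h
  apply hx
  rw [← dil_neg_mulVec_dil_mulVec G s x, h, mulVec_zero]

section
attribute [local instance] Matrix.linftyOpNormedRing Matrix.linftyOpNormedAlgebra

/-- Differentiating the exponential needs a normed algebra of matrices. The entrywise form keeps the
auxiliary norm out of the statement. -/
theorem hasDerivAt_dil_apply (G : Mat n n) (s : ℝ) (i j : Fin n) :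
    HasDerivAt (fun s => dil G s i j) ((dil G s * G) i j) s := by
  have h := hasDerivAt_exp_smul_const (𝕂 := ℝ) G s
  let e : Mat n n →L[ℝ] ℝ := LinearMap.toContinuousLinearMap
    { toFun := fun M => M i j, map_add' := fun _ _ => rfl, map_smul' := fun _ _ => rfl }
  exact e.hasFDerivAt.comp_hasDerivAt s h

end

theorem dil_commute (G : Mat n n) (s : ℝ) : dil G s * G = G * dil G s := by
  have : Commute (s • G) G := (Commute.refl G).smul_left s
  exact this.exp_left.eq

theorem hasDerivWithinAt_dil_mulVec {G : Mat n n} {σ : ℝ → ℝ} {σ' : ℝ} {y : ℝ → Vec n}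
    {y' : Vec n} {s : Set ℝ} {t : ℝ} (hσ : HasDerivWithinAt σ σ' s t)
    (hy : HasDerivWithinAt y y' s t) :
    HasDerivWithinAt (fun τ => dil G (σ τ) *ᵥ y τ)
      (dil G (σ t) *ᵥ (σ' • (G *ᵥ y t) + y')) s t := by
  rw [hasDerivWithinAt_pi] at hy ⊢
  intro i
  have h := HasDerivWithinAt.fun_sum (u := Finset.univ) fun j _ =>
    ((hasDerivAt_dil_apply G (σ t) i j).comp_hasDerivWithinAt t hσ).mul (hy j)
  convert! h using 1
  rw [Finset.sum_add_distrib, mulVec_add, mulVec_smul, mulVec_mulVec]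
  simp only [Pi.add_apply, Pi.smul_apply, smul_eq_mul, mulVec, dotProduct, Finset.mul_sum,
    Function.comp_apply]
  congr 1
  exact Finset.sum_congr rfl fun j _ => by ring

theorem continuous_dil_apply (G : Mat n n) (i j : Fin n) : Continuous fun s => dil G s i j :=
  continuous_iff_continuousAt.2 fun s => (hasDerivAt_dil_apply G s i j).continuousAt

theorem continuous_dil_mulVec (G : Mat n n) :
    Continuous fun p : ℝ × Vec n => dil G p.1 *ᵥ p.2 := by
  refine continuous_pi fun i => ?_
  simp only [mulVec, dotProduct]
  refine continuous_finsetSum _ fun j _ => ?_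
  exact ((continuous_dil_apply G i j).comp continuous_fst).mul
    ((continuous_apply j).comp continuous_snd)

theorem hasDerivAt_qform_dil (G P : Mat n n) (x : Vec n) (s : ℝ) :
    HasDerivAt (fun s => qform P (dil G s *ᵥ x)) (qform (P * G + Gᵀ * P) (dil G s *ᵥ x)) s := by
  have h := hasDerivWithinAt_qform (P := P) (hasDerivWithinAt_dil_mulVec (G := G)
    (hasDerivWithinAt_id s univ) (hasDerivWithinAt_const s univ x))
  rw [hasDerivWithinAt_univ] at h
  convert! h using 1
  simp only [one_smul, add_zero, id]
  rw [mulVec_mulVec, dil_commute, ← mulVec_mulVec, dotProduct_mulVec_add_eq_qform]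

/-- Conservation of `xᵀ P x` along `exp (s G)` when `P G + Gᵀ P = 0`. -/
theorem qform_dil_eq {G P : Mat n n} (h : P * G + Gᵀ * P = 0) (s : ℝ) (x : Vec n) :
    qform P (dil G s *ᵥ x) = qform P x := by
  have hd : ∀ s, HasDerivAt (fun s => qform P (dil G s *ᵥ x)) 0 s := fun s => by
    simpa [h, qform] using hasDerivAt_qform_dil G P x s
  have := is_const_of_deriv_eq_zero (fun s => (hd s).differentiableAt) (fun s => (hd s).deriv) s 0
  simpa [dil_zero] using this

end Dilations

/-! ### The canonical homogeneous norm -/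

/-- The dilation generated by `G` is strictly monotone for the norm `√(xᵀ P x)`. -/
structure IsMonotone {n : ℕ} (G P : Mat n n) : Prop where
  posDef : P.PosDef
  posDef_lyap : (P * G + Gᵀ * P).PosDef

namespace IsMonotone

variable {n : ℕ} {G P : Mat n n}

theorem strictMono_qform_dil (h : IsMonotone G P) {x : Vec n} (hx : x ≠ 0) :
    StrictMono fun s => qform P (dil G s *ᵥ x) :=
  strictMono_of_hasDerivAt_pos (hasDerivAt_qform_dil G P x) fun s =>
    qform_pos h.posDef_lyap (dil_mulVec_ne_zero G s hx)

/-- Since `P ≤ C(PG + GᵀP)`, the function `q(s) = qform P (d(s)x)` satisfies `q' ≥ q/C`, so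
`e^{-s/C} q(s)` is nondecreasing; compare with its value at `s = 0`. -/
theorem exists_qform_dil_le_exp_mul (h : IsMonotone G P) :
    ∃ β > 0, ∀ (x : Vec n) (s : ℝ), s ≤ 0 →
      qform P (dil G s *ᵥ x) ≤ Real.exp (β * s) * qform P x := by
  obtain ⟨C, hC, hle⟩ := exists_qform_le_mul_qform h.posDef_lyap P
  refine ⟨C⁻¹, inv_pos.2 hC, fun x s hs => ?_⟩
  have hd : ∀ s, HasDerivAt (fun s => Real.exp (-(C⁻¹ * s)) * qform P (dil G s *ᵥ x))
      (Real.exp (-(C⁻¹ * s)) * -(C⁻¹ * 1) * qform P (dil G s *ᵥ x)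
        + Real.exp (-(C⁻¹ * s)) * qform (P * G + Gᵀ * P) (dil G s *ᵥ x)) s := fun s =>
    (((hasDerivAt_id s).const_mul C⁻¹).neg.exp).mul (hasDerivAt_qform_dil G P x s)
  have hm := monotone_of_hasDerivAt_nonneg hd (fun s => by
    have h1 := hle (dil G s *ᵥ x)
    have h2 : C⁻¹ * qform P (dil G s *ᵥ x) ≤ qform (P * G + Gᵀ * P) (dil G s *ᵥ x) := by
      rw [inv_mul_eq_div, div_le_iff₀ hC, mul_comm]
      exact h1
    have h3 := mul_le_mul_of_nonneg_left h2 (Real.exp_pos (-(C⁻¹ * s))).le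
    simp only [Pi.zero_apply]
    linarith) hs
  simp only [mul_zero, neg_zero, Real.exp_zero, one_mul, dil_zero, one_mulVec] at hm
  rw [Real.exp_neg, inv_mul_eq_div, div_le_iff₀ (Real.exp_pos _), mul_comm] at hm
  exact hm

theorem exists_qform_dil_neg_eq_one (h : IsMonotone G P) {x : Vec n} (hx : x ≠ 0) :
    ∃ s : ℝ, qform P (dil G (-s) *ᵥ x) = 1 := by
  obtain ⟨β, hβ, hle⟩ := h.exists_qform_dil_le_exp_mul
  have hq := qform_pos h.posDef hx
  -- Contraction at rate `β` over a dilation parameter of length `|L|/β` is enough to reach level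
  -- `1` from above, and its inverse from below; the intermediate value theorem does the rest.
  set L := Real.log (qform P x)
  have hL : Real.exp L = qform P x := Real.exp_log hq
  have hcont : Continuous fun s => qform P (dil G (-s) *ᵥ x) :=
    (continuous_qform P).comp ((continuous_dil_mulVec G).comp
      (continuous_neg.prodMk continuous_const))
  have hhi : qform P (dil G (-(|L| / β)) *ᵥ x) ≤ 1 := by
    refine (hle x _ (neg_nonpos.2 (by positivity))).trans ?_
    rw [← hL, ← Real.exp_add, Real.exp_le_one_iff]
    have : β * -(|L| / β) = -|L| := by field_simp
    rw [this]
    linarith [le_abs_self L]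
  have hlo : 1 ≤ qform P (dil G (|L| / β) *ᵥ x) := by
    have h1 := hle (dil G (|L| / β) *ᵥ x) (-(|L| / β)) (neg_nonpos.2 (by positivity))
    have h2 : β * -(|L| / β) = -|L| := by field_simp
    rw [dil_neg_mulVec_dil_mulVec, h2, ← hL, Real.exp_neg, inv_mul_eq_div,
      le_div_iff₀ (Real.exp_pos _), ← Real.exp_add] at h1
    refine le_trans ?_ h1
    rw [Real.one_le_exp_iff]
    linarith [neg_abs_le L]
  have := intermediate_value_univ (|L| / β) (-(|L| / β)) hcont
  exact this ⟨hhi, by simpa using hlo⟩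

theorem qform_dil_log_homNorm (h : IsMonotone G P) {x : Vec n} (hx : x ≠ 0) :
    qform P (dil G (-Real.log (homNorm G P x)) *ᵥ x) = 1 := by
  have hex : ∃ s : ℝ, wnorm P (dil G (-s) *ᵥ x) = 1 := by
    simpa only [wnorm_eq_one_iff] using h.exists_qform_dil_neg_eq_one hx
  have := Classical.epsilon_spec hex
  rw [wnorm_eq_one_iff] at this
  rwa [homNorm, if_neg hx, Real.log_exp]

theorem homNorm_pos {x : Vec n} (hx : x ≠ 0) : 0 < homNorm G P x := by
  rw [homNorm, if_neg hx]
  exact Real.exp_pos _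

theorem homNorm_zero : homNorm G P (0 : Vec n) = 0 := by simp [homNorm]

theorem homNorm_nonneg (x : Vec n) : 0 ≤ homNorm G P x := by
  rcases eq_or_ne x 0 with rfl | hx
  · rw [homNorm_zero]
  · exact (homNorm_pos hx).le

/-- Monotonicity of `s ↦ q(d(s)x)` turns sublevel sets of the homogeneous norm into ellipsoids, the
origin included. Most later estimates go through this equivalence. -/
theorem homNorm_le_exp_iff (h : IsMonotone G P) {x : Vec n} {s : ℝ} :
    homNorm G P x ≤ Real.exp s ↔ qform P (dil G (-s) *ᵥ x) ≤ 1 := by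
  rcases eq_or_ne x 0 with rfl | hx
  · simp [homNorm_zero, qform_zero, Real.exp_nonneg]
  · rw [← Real.log_le_iff_le_exp (homNorm_pos hx), ← h.qform_dil_log_homNorm hx,
      (h.strictMono_qform_dil hx).le_iff_le, neg_le_neg_iff]

theorem homNorm_eq_exp_of_qform (h : IsMonotone G P)
    {x : Vec n} {s : ℝ} (hs : qform P (dil G (-s) *ᵥ x) = 1) :
    homNorm G P x = Real.exp s := by
  have hx : x ≠ 0 := by rintro rfl; simp [qform_zero] at hs
  have := (h.strictMono_qform_dil hx).injective
    ((h.qform_dil_log_homNorm hx).trans hs.symm)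
  rw [← neg_injective this, Real.exp_log (homNorm_pos hx)]

/-- For fixed `s`, comparing the logarithm with `s` amounts to comparing `q(d(-s)y)` with `1`, and
this quantity is continuous in `y`. -/
theorem continuousAt_log_homNorm (h : IsMonotone G P) {x : Vec n} (hx : x ≠ 0) :
    ContinuousAt (fun y => Real.log (homNorm G P y)) x := by
  have hq : ∀ s, Continuous fun y => qform P (dil G (-s) *ᵥ y) := fun s =>
    (continuous_qform P).comp
      ((continuous_dil_mulVec G).comp (continuous_const.prodMk continuous_id))
  have hne : ∀ᶠ y in 𝓝 x, y ≠ 0 := isOpen_ne.mem_nhds hx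
  have h1 := h.qform_dil_log_homNorm hx
  refine tendsto_order.2 ⟨fun s hs => ?_, fun s hs => ?_⟩
  · have : 1 < qform P (dil G (-s) *ᵥ x) := by
      rw [← h1]; exact h.strictMono_qform_dil hx (neg_lt_neg hs)
    filter_upwards [(hq s).continuousAt.eventually_const_lt this, hne] with y hy hy0
    rw [Real.lt_log_iff_exp_lt (homNorm_pos hy0)]
    exact not_le.1 fun hle => absurd (h.homNorm_le_exp_iff.1 hle) (not_le.2 hy)
  · have : qform P (dil G (-s) *ᵥ x) < 1 := by
      rw [← h1]; exact h.strictMono_qform_dil hx (neg_lt_neg hs)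
    filter_upwards [(hq s).continuousAt.eventually_lt_const this, hne] with y hy hy0
    have h2 := h.qform_dil_log_homNorm hy0
    rw [← h2] at hy
    exact neg_lt_neg_iff.1 ((h.strictMono_qform_dil hy0).lt_iff_lt.1 hy)

/-- Here `x = d(s)y` with `y` in the unit `P`-ball, and `d(s)` contracts exponentially for `s ≤ 0`.
-/
theorem exists_homNorm_le_imp_norm_le (h : IsMonotone G P) :
    ∃ C > 0, ∃ β > 0, ∀ (x : Vec n) (s : ℝ), s ≤ 0 →
    homNorm G P x ≤ Real.exp s → ‖x‖ ^ 2 ≤ C * Real.exp (β * s) := by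
  obtain ⟨β, hβ, hle⟩ := h.exists_qform_dil_le_exp_mul
  obtain ⟨c, hc, hlow⟩ := exists_mul_norm_sq_le_qform h.posDef
  refine ⟨c⁻¹, inv_pos.2 hc, β, hβ, fun x s hs hx => ?_⟩
  have h1 := hle (dil G (-s) *ᵥ x) s hs
  rw [dil_mulVec_dil_neg_mulVec] at h1
  have h2 := mul_le_mul_of_nonneg_left (h.homNorm_le_exp_iff.1 hx) (Real.exp_pos (β * s)).le
  rw [inv_mul_eq_div, le_div_iff₀ hc]
  linarith [hlow x]

theorem exists_homNorm_le_imp_enorm₂_lt (h : IsMonotone G P) {ε : ℝ} (hε : 0 < ε) :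
    ∃ s : ℝ, ∀ x : Vec n, homNorm G P x ≤ Real.exp s → enorm₂ x < ε := by
  obtain ⟨C, hC, β, hβ, hb⟩ := h.exists_homNorm_le_imp_norm_le
  obtain ⟨D, hD, hnorm⟩ := exists_enorm₂_le_mul_norm (n := n)
  have ht : Tendsto (fun s => C * Real.exp (β * s)) atBot (𝓝 (C * 0)) :=
    (Real.tendsto_exp_atBot.comp (tendsto_id.const_mul_atBot hβ)).const_mul C
  rw [mul_zero] at ht
  obtain ⟨s, hs, hs0⟩ := ((ht.eventually_lt_const (by positivity : 0 < (ε / D) ^ 2)).and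
    (eventually_le_atBot 0)).exists
  refine ⟨s, fun x hx => (hnorm x).trans_lt ?_⟩
  have := lt_of_pow_lt_pow_left₀ 2 (by positivity) ((hb x s hs0 hx).trans_lt hs)
  rwa [lt_div_iff₀ hD, mul_comm] at this

theorem exists_enorm₂_lt_imp_homNorm_le (h : IsMonotone G P) (s : ℝ) :
    ∃ δ > 0, ∀ x : Vec n, enorm₂ x < δ → homNorm G P x ≤ Real.exp s := by
  obtain ⟨D, hD, hnorm⟩ := exists_norm_le_mul_enorm₂ (n := n)
  have hq : Continuous fun y => qform P (dil G (-s) *ᵥ y) :=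
    (continuous_qform P).comp
      ((continuous_dil_mulVec G).comp (continuous_const.prodMk continuous_id))
  have hev := hq.continuousAt.eventually_lt_const
    (by simp [qform_zero] : qform P (dil G (-s) *ᵥ (0 : Vec n)) < 1)
  obtain ⟨r, hr, hball⟩ := Metric.eventually_nhds_iff.1 hev
  refine ⟨r / D, by positivity, fun x hx => h.homNorm_le_exp_iff.2 (hball ?_).le⟩
  rw [dist_zero_right]
  rw [lt_div_iff₀ hD, mul_comm] at hx
  exact (hnorm x).trans_lt hx

theorem exists_enorm₂_le_imp_homNorm_le (h : IsMonotone G P) (r : ℝ) :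
    ∃ s : ℝ, ∀ x : Vec n, enorm₂ x ≤ r → homNorm G P x ≤ Real.exp s := by
  obtain ⟨D, hD, hnorm⟩ := exists_norm_le_mul_enorm₂ (n := n)
  obtain ⟨C, hC, hup⟩ := exists_qform_le_mul_norm_sq P
  obtain ⟨β, hβ, hle⟩ := h.exists_qform_dil_le_exp_mul
  have ht : Tendsto (fun s => Real.exp (β * -s) * (C * (D * r) ^ 2)) atTop
      (𝓝 (0 * (C * (D * r) ^ 2))) :=
    (Real.tendsto_exp_atBot.comp (tendsto_neg_atTop_atBot.const_mul_atBot hβ)).mul_const _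
  rw [zero_mul] at ht
  obtain ⟨s, hs, hs0⟩ := ((ht.eventually_lt_const one_pos).and (eventually_ge_atTop 0)).exists
  refine ⟨s, fun x hx => h.homNorm_le_exp_iff.2 ?_⟩
  refine (hle x (-s) (by linarith)).trans (le_trans ?_ hs.le)
  refine mul_le_mul_of_nonneg_left ((hup x).trans ?_) (Real.exp_pos _).le
  gcongr
  exact (hnorm x).trans (by gcongr)

/-- The sublevel set is the image under `d(s)` of the compact unit `P`-ball, so no sign condition on
`s` is needed. -/
theorem exists_homNorm_le_imp_norm_le_const (h : IsMonotone G P) (s : ℝ) :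
    ∃ r > 0, ∀ x : Vec n, homNorm G P x ≤ Real.exp s → ‖x‖ ≤ r := by
  obtain ⟨c, hc, hlow⟩ := exists_mul_norm_sq_le_qform h.posDef
  have hK : IsCompact {y : Vec n | qform P y ≤ 1} := by
    refine Metric.isCompact_of_isClosed_isBounded
      (isClosed_le (continuous_qform P) continuous_const) ?_
    refine (Metric.isBounded_closedBall (x := (0 : Vec n)) (r := √(c⁻¹))).subset fun y hy => ?_
    rw [mem_closedBall_zero_iff]
    refine Real.le_sqrt_of_sq_le ?_
    rw [← one_div, le_div_iff₀ hc, mul_comm]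
    exact (hlow y).trans hy
  have hcont : Continuous fun y : Vec n => dil G s *ᵥ y :=
    (continuous_dil_mulVec G).comp (continuous_const.prodMk continuous_id)
  obtain ⟨r, hr, hle⟩ := (hK.image hcont).isBounded.exists_pos_norm_le
  refine ⟨r, hr, fun x hx => hle x ⟨dil G (-s) *ᵥ x, h.homNorm_le_exp_iff.1 hx, ?_⟩⟩
  exact dil_mulVec_dil_neg_mulVec G s x

end IsMonotone

/-! ### General facts on impulsive systems -/

theorem IsLeftLimit.unique {n : ℕ} {x : ℝ → Vec n} {t : ℝ} {z w : Vec n}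
    (hz : IsLeftLimit x t z) (hw : IsLeftLimit x t w) : z = w :=
  tendsto_nhds_unique hz hw

theorem IsLeftLimit.congr {n : ℕ} {x y : ℝ → Vec n} {a t : ℝ} {z : Vec n} (hat : a < t)
    (hxy : EqOn x y (Ico a t)) (hz : IsLeftLimit x t z) : IsLeftLimit y t z := by
  refine Tendsto.congr' ?_ hz
  filter_upwards [Ico_mem_nhdsLT hat] with τ hτ using hxy hτ

theorem IsLeftLimit.mem_of_isClosed {n : ℕ} {x : ℝ → Vec n} {a t : ℝ} {z : Vec n} {C : Set (Vec n)}
    (hz : IsLeftLimit x t z) (hC : IsClosed C) (hat : a < t) (h : ∀ τ ∈ Ioo a t, x τ ∈ C) :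
    z ∈ C := by
  refine hC.mem_of_tendsto hz ?_
  filter_upwards [Ioo_mem_nhdsLT hat] with τ hτ using h τ hτ

theorem isLeftLimit_comp_sub_iff {n : ℕ} {x y : ℝ → Vec n} {T t : ℝ} {z : Vec n} (hTt : T < t)
    (hxy : ∀ τ, T ≤ τ → x τ = y (τ - T)) :
    IsLeftLimit x t z ↔ IsLeftLimit y (t - T) z := by
  constructor
  · intro h
    have hm : Tendsto (fun τ => τ + T) (𝓝[<] (t - T)) (𝓝[<] t) := by
      refine tendsto_nhdsWithin_iff.2 ⟨?_, ?_⟩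
      · have : Tendsto (fun τ => τ + T) (𝓝 (t - T)) (𝓝 (t - T + T)) :=
          (continuous_add_const T).tendsto _
        rw [sub_add_cancel] at this
        exact this.mono_left nhdsWithin_le_nhds
      · filter_upwards [self_mem_nhdsWithin] with τ hτ
        have : τ < t - T := hτ
        exact mem_Iio.2 (by linarith)
    refine (Tendsto.comp h hm).congr' ?_
    filter_upwards [Ioo_mem_nhdsLT (sub_pos.2 hTt)] with τ hτ
    simp [hxy (τ + T) (by linarith [hτ.1])]
  · intro h
    have hm : Tendsto (fun τ => τ - T) (𝓝[<] t) (𝓝[<] (t - T)) := by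
      refine tendsto_nhdsWithin_iff.2 ⟨?_, ?_⟩
      · exact ((continuous_sub_right T).tendsto t).mono_left nhdsWithin_le_nhds
      · filter_upwards [self_mem_nhdsWithin] with τ hτ
        have : τ < t := hτ
        exact mem_Iio.2 (by linarith)
    refine (Tendsto.comp h hm).congr' ?_
    filter_upwards [Ioo_mem_nhdsLT hTt] with τ hτ
    simp [hxy τ hτ.1.le]

namespace IsSolution

variable {n : ℕ} {f : Vec n → Vec n} {R : Mat n n} {Ω : Set (Vec n)} {x₀ : Vec n} {T : EReal}
  {x : ℝ → Vec n}

/-- A function that coincides with solutions on arbitrarily large subintervals is a solution. -/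
theorem of_forall_exists_eqOn {y : ℝ → Vec n} (hT : 0 < T)
    (h : ∀ b : ℝ, 0 ≤ b → (b : EReal) < T → ∃ (T' : EReal) (x' : ℝ → Vec n), (b : EReal) < T' ∧
      IsSolution f R Ω x₀ T' x' ∧ ∀ t : ℝ, 0 ≤ t → (t : EReal) < T' → y t = x' t) :
    IsSolution f R Ω x₀ T y where
  pos := hT
  init := by
    obtain ⟨T', x', h0, hs, he⟩ := h 0 le_rfl (by simpa using hT)
    rw [he 0 le_rfl h0]
    exact hs.init
  rightCont := by
    intro t ht htT
    obtain ⟨T', x', h0, hs, he⟩ := h t ht htT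
    refine (hs.rightCont t ht h0).congr_of_eventuallyEq ?_ (he t ht h0)
    have : ∀ᶠ τ : ℝ in 𝓝[≥] t, (τ : EReal) < T' :=
      nhdsWithin_le_nhds (continuous_coe_real_ereal.continuousAt.eventually_lt_const h0)
    filter_upwards [this, self_mem_nhdsWithin] with τ h1 h2 using he τ (ht.trans h2) h1
  jump := by
    intro t ht htT
    obtain ⟨T', x', h0, hs, he⟩ := h t ht.le htT
    obtain ⟨z, hz, h1, h2⟩ := hs.jump t ht h0
    rw [he t ht.le h0]
    refine ⟨z, hz.congr ht fun τ hτ => (he τ hτ.1 ?_).symm, h1, h2⟩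
    exact (EReal.coe_lt_coe_iff.2 hτ.2).trans h0
  flow := by
    intro a b ha hab hb hno
    obtain ⟨T', x', h0, hs, he⟩ := h b (ha.trans hab) hb
    have hlt : ∀ τ : ℝ, τ ≤ b → (τ : EReal) < T' := fun τ hτ =>
      (EReal.coe_le_coe_iff.2 hτ).trans_lt h0
    have heq : ∀ τ ∈ Icc a b, y τ = x' τ := fun τ hτ => he τ (ha.trans hτ.1) (hlt τ hτ.2)
    obtain ⟨h1, h2⟩ := hs.flow a b ha hab h0 fun t ht z hz => hno t ht z
      (hz.congr (ha.trans_lt ht.1) fun τ hτ => (he τ hτ.1 (hlt τ (hτ.2.le.trans ht.2))).symm)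
    have hcongr : ∀ τ ∈ uIcc a b, f (x' τ) = f (y τ) := fun τ hτ => by
      rw [uIcc_of_le hab] at hτ
      rw [heq τ hτ]
    rw [heq b (right_mem_Icc.2 hab), heq a (left_mem_Icc.2 hab),
      ← intervalIntegral.integral_congr hcongr]
    refine ⟨h1.congr fun τ hτ => ?_, h2⟩
    exact hcongr τ (uIoc_subset_uIcc hτ)

theorem eq_of_isLeftLimit (hx : IsSolution f R Ω x₀ T x)
    {t : ℝ} (ht : 0 < t) (htT : (t : EReal) < T) {z : Vec n}
    (hz : IsLeftLimit x t z) : (z ∈ Ω → x t = R *ᵥ z) ∧ (z ∉ Ω → x t = z) := by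
  obtain ⟨w, hw, h⟩ := hx.jump t ht htT
  exact hw.unique hz ▸ h

/-- Reset times do not accumulate from the right. -/
theorem exists_forall_Ioc_notMem (hx : IsSolution f R Ω x₀ T x) (hΩ : IsClosed Ω)
    (hR : ∀ z ∈ Ω, R *ᵥ z ∉ Ω) {t : ℝ} (ht : 0 ≤ t) (htT : (t : EReal) < T) :
    ∃ ε > 0, ((t + ε : ℝ) : EReal) < T ∧
      ∀ s ∈ Ioc t (t + ε), ∀ z, IsLeftLimit x s z → z ∉ Ω := by
  have hcontR : Continuous fun z : Vec n => R *ᵥ z := continuous_const.matrix_mulVec continuous_id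
  -- By right continuity, a reset soon after `t` would have both its left limit `z` and `x s = R z`
  -- in `C`. If `x t ∈ Ω` (possible only at `t = 0`), `C` is small enough that `R` moves its points
  -- out of `C`; otherwise `C` misses `Ω`.
  obtain ⟨C, hCn, hC, hdisj⟩ : ∃ C ∈ 𝓝 (x t), IsClosed C ∧ ∀ z ∈ C, z ∈ Ω → R *ᵥ z ∉ C := by
    by_cases hw : x t ∈ Ω
    · have hne : R *ᵥ x t ≠ x t := fun h => hR _ hw (h.symm ▸ hw)
      obtain ⟨U, V, hU, hV, hUV⟩ := t2_separation_nhds hne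
      obtain ⟨C, hCn, hC, hsub⟩ := exists_mem_nhds_isClosed_subset
        (inter_mem hV (hcontR.continuousAt.preimage_mem_nhds hU))
      exact ⟨C, hCn, hC, fun z hz _ hRz => hUV.le_bot ⟨(hsub hz).2, (hsub hRz).1⟩⟩
    · obtain ⟨C, hCn, hC, hsub⟩ := exists_mem_nhds_isClosed_subset (hΩ.isOpen_compl.mem_nhds hw)
      exact ⟨C, hCn, hC, fun z hz hzΩ => absurd hzΩ (hsub hz)⟩
  have hev : ∀ᶠ τ : ℝ in 𝓝[≥] t, x τ ∈ C ∧ (τ : EReal) < T :=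
    ((hx.rightCont t ht htT).eventually hCn).and
      (nhdsWithin_le_nhds (continuous_coe_real_ereal.continuousAt.eventually_lt_const htT))
  obtain ⟨u, hu, hsub⟩ := mem_nhdsGE_iff_exists_Icc_subset.1 hev
  have hu' : t < u := hu
  refine ⟨u - t, sub_pos.2 hu, ?_, fun s hs z hz hzΩ => ?_⟩
  · rw [add_sub_cancel]
    exact (hsub (right_mem_Icc.2 hu'.le)).2
  · rw [add_sub_cancel] at hs
    have hzC : z ∈ C := hz.mem_of_isClosed hC hs.1 fun τ hτ =>
      (hsub ⟨hτ.1.le, hτ.2.le.trans hs.2⟩).1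
    have hsC := hsub ⟨hs.1.le, hs.2⟩
    have := (hx.eq_of_isLeftLimit (ht.trans_lt hs.1) hsC.2 hz).1 hzΩ
    exact hdisj z hzC hzΩ (this ▸ hsC.1)

/-- Where the vector field is continuous, solutions have it as their right derivative. -/
theorem hasDerivWithinAt_Ici (hx : IsSolution f R Ω x₀ T x) (hΩ : IsClosed Ω)
    (hR : ∀ z ∈ Ω, R *ᵥ z ∉ Ω) {t : ℝ} (ht : 0 ≤ t) (htT : (t : EReal) < T)
    (hf : ContinuousAt f (x t)) : HasDerivWithinAt x (f (x t)) (Ici t) t := by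
  obtain ⟨ε, hε, hεT, hno⟩ := hx.exists_forall_Ioc_notMem hΩ hR ht htT
  have hflow : ∀ b ∈ Icc t (t + ε), IntervalIntegrable (fun τ => f (x τ)) volume t b ∧
      x b = x t + ∫ τ in t..b, f (x τ) := fun b hb =>
    hx.flow t b ht hb.1 ((EReal.coe_le_coe_iff.2 hb.2).trans_lt hεT) fun s hs =>
      hno s ⟨hs.1, hs.2.trans hb.2⟩
  have hcont : ContinuousWithinAt (fun τ => f (x τ)) (Ioi t) t :=
    (ContinuousAt.comp_continuousWithinAt (g := f) hf (hx.rightCont t ht htT)).mono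
      Ioi_subset_Ici_self
  have hmeas : StronglyMeasurableAtFilter (fun τ => f (x τ)) (𝓝[>] t) volume :=
    ⟨Ioc t (t + ε), Ioc_mem_nhdsGT (by linarith),
      (hflow (t + ε) ⟨by linarith, le_rfl⟩).1.1.aestronglyMeasurable⟩
  have hint := (intervalIntegral.integral_hasDerivWithinAt_right (a := t)
    (IntervalIntegrable.refl (f := fun τ => f (x τ)) (μ := volume) (a := t))
    (s := Ici t) (t := Ioi t) hmeas hcont).const_add (x t)
  refine hint.congr_of_eventuallyEq ?_ (by simp)
  filter_upwards [Icc_mem_nhdsGE (show t < t + ε by linarith)] with b hb using (hflow b hb).2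

theorem norm_sub_le (hx : IsSolution f R Ω x₀ T x)
    {M a b : ℝ} (hM : ∀ t : ℝ, 0 ≤ t → (t : EReal) < T → ‖f (x t)‖ ≤ M)
    (ha : 0 ≤ a) (hab : a ≤ b) (hb : (b : EReal) < T)
    (hno : ∀ t ∈ Ioc a b, ∀ z, IsLeftLimit x t z → z ∉ Ω) : ‖x b - x a‖ ≤ M * (b - a) := by
  rw [(hx.flow a b ha hab hb hno).2, add_sub_cancel_left, ← abs_of_nonneg (sub_nonneg.2 hab)]
  refine intervalIntegral.norm_integral_le_of_norm_le_const fun τ hτ => ?_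
  rw [uIoc_of_le hab] at hτ
  exact hM τ (ha.trans hτ.1.le) ((EReal.coe_le_coe_iff.2 hτ.2).trans_lt hb)

/-- If `b` is a reset time, then there is a first reset time in `(a, b]`. -/
theorem exists_first_reset (hx : IsSolution f R Ω x₀ T x) (hΩ : IsClosed Ω)
    (hR : ∀ z ∈ Ω, R *ᵥ z ∉ Ω) {a b : ℝ} (ha : 0 ≤ a) (hab : a < b) (hb : (b : EReal) < T)
    (hreset : ∃ z ∈ Ω, IsLeftLimit x b z) :
    ∃ c ∈ Ioc a b, (∃ z ∈ Ω, IsLeftLimit x c z) ∧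
      ∀ t ∈ Ioo a c, ∀ z, IsLeftLimit x t z → z ∉ Ω := by
  set S := {t | t ∈ Ioc a b ∧ ∃ z ∈ Ω, IsLeftLimit x t z} with hS
  have hbS : b ∈ S := ⟨right_mem_Ioc.2 hab, hreset⟩
  have hbdd : BddBelow S := ⟨a, fun t ht => ht.1.1.le⟩
  have hac : a ≤ sInf S := le_csInf ⟨b, hbS⟩ fun t ht => ht.1.1.le
  have hcb : sInf S ≤ b := csInf_le hbdd hbS
  -- The infimum is attained, since reset times do not accumulate from the right.
  have hmem : sInf S ∈ S := by
    by_contra hnot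
    obtain ⟨ε, hε, -, hno⟩ := hx.exists_forall_Ioc_notMem hΩ hR (ha.trans hac)
      ((EReal.coe_le_coe_iff.2 hcb).trans_lt hb)
    obtain ⟨t, htS, hlt⟩ := exists_lt_of_csInf_lt ⟨b, hbS⟩ (lt_add_of_pos_right (sInf S) hε)
    obtain ⟨z, hzΩ, hz⟩ := htS.2
    have : sInf S < t := lt_of_le_of_ne (csInf_le hbdd htS) fun h => hnot (h ▸ htS)
    exact hno t ⟨this, hlt.le⟩ z hz hzΩ
  refine ⟨sInf S, hmem.1, hmem.2, fun t ht z hz hzΩ => ?_⟩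
  exact absurd (csInf_le hbdd ⟨⟨ht.1, ht.2.le.trans hcb⟩, z, hzΩ, hz⟩) (not_le.2 ht.2)

/-- Along a bounded solution, consecutive resets are separated by a positive dwell time. -/
theorem exists_dwell_time (hx : IsSolution f R Ω x₀ T x) (hΩ : IsClosed Ω)
    (hR : ∀ z ∈ Ω, R *ᵥ z ∉ Ω) {r M : ℝ} (hr : ∀ t : ℝ, 0 ≤ t → (t : EReal) < T → ‖x t‖ ≤ r)
    (hM : ∀ t : ℝ, 0 ≤ t → (t : EReal) < T → ‖f (x t)‖ ≤ M) :
    ∃ δ > 0, ∀ a b : ℝ, 0 < a → a < b → (b : EReal) < T → (∃ z ∈ Ω, IsLeftLimit x a z) →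
      (∃ z ∈ Ω, IsLeftLimit x b z) → δ ≤ b - a := by
  have hcontR : Continuous fun z : Vec n => R *ᵥ z := continuous_const.matrix_mulVec continuous_id
  have hK : IsCompact ((fun z => R *ᵥ z) '' (Ω ∩ Metric.closedBall 0 r)) :=
    ((isCompact_closedBall (0 : Vec n) r).inter_left hΩ).image hcontR
  -- After a reset the state lies in this compact set, at distance more than `D` from `Ω`, and it
  -- must travel back to `Ω` at speed at most `M` before the next reset. The bound `M + 1` below
  -- avoids division by zero.
  obtain ⟨D, hD, hsep⟩ := Metric.exists_pos_forall_lt_edist hK hΩ (by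
    rw [Set.disjoint_left]
    rintro _ ⟨z, hz, rfl⟩
    exact hR z hz.1)
  have hM0 : 0 ≤ M := (norm_nonneg _).trans (hM 0 le_rfl (by simpa using hx.pos))
  refine ⟨D / (M + 1), by positivity, fun a b ha hab hb ⟨z, hzΩ, hz⟩ hreset => ?_⟩
  have haT : (a : EReal) < T := (EReal.coe_lt_coe_iff.2 hab).trans hb
  obtain ⟨c, hc, ⟨w, hwΩ, hw⟩, hno⟩ := hx.exists_first_reset hΩ hR ha.le hab hb hreset
  have hcT : (c : EReal) < T := (EReal.coe_le_coe_iff.2 hc.2).trans_lt hb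
  have hzr : z ∈ Metric.closedBall (0 : Vec n) r :=
    hz.mem_of_isClosed Metric.isClosed_closedBall ha fun τ hτ => by
      simpa using hr τ hτ.1.le ((EReal.coe_lt_coe_iff.2 hτ.2).trans haT)
  have hwa : w ∈ Metric.closedBall (x a) (M * (c - a)) :=
    hw.mem_of_isClosed Metric.isClosed_closedBall hc.1 fun τ hτ => by
      rw [Metric.mem_closedBall, dist_eq_norm]
      refine (hx.norm_sub_le hM ha.le hτ.1.le ((EReal.coe_lt_coe_iff.2 hτ.2).trans hcT)
        fun t ht => hno t ⟨ht.1, ht.2.trans_lt hτ.2⟩).trans ?_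
      gcongr
      exact hτ.2.le
  have hlt := hsep _ ⟨z, ⟨hzΩ, hzr⟩, rfl⟩ w hwΩ
  simp only at hlt
  rw [← (hx.eq_of_isLeftLimit ha haT hz).1 hzΩ, edist_nndist, ENNReal.coe_lt_coe,
    ← NNReal.coe_lt_coe, coe_nndist, dist_comm] at hlt
  rw [div_le_iff₀ (by positivity)]
  have h1 : M * (c - a) ≤ M * (b - a) := by gcongr; exact hc.2
  have h2 := Metric.mem_closedBall.1 hwa
  nlinarith

end IsSolution

/-! ### Behaviour at a finite end time and concatenation. -/

namespace IsSolution

variable {n : ℕ} {f : Vec n → Vec n} {R : Mat n n} {Ω : Set (Vec n)} {x₀ : Vec n} {T : ℝ}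
  {x : ℝ → Vec n}

/-- A bounded solution on a bounded interval has a left limit at the end. -/
theorem exists_isLeftLimit_end (hx : IsSolution f R Ω x₀ T x) (hΩ : IsClosed Ω)
    (hR : ∀ z ∈ Ω, R *ᵥ z ∉ Ω) {r M : ℝ}
    (hr : ∀ t : ℝ, 0 ≤ t → t < T → ‖x t‖ ≤ r) (hM : ∀ t : ℝ, 0 ≤ t → t < T → ‖f (x t)‖ ≤ M) :
    ∃ z, IsLeftLimit x T z := by
  have hT : 0 < T := by exact_mod_cast hx.pos
  have hM' : ∀ t : ℝ, 0 ≤ t → (t : EReal) < T → ‖f (x t)‖ ≤ M := fun t h0 h1 =>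
    hM t h0 (EReal.coe_lt_coe_iff.1 h1)
  obtain ⟨δ, hδ, hdwell⟩ := hx.exists_dwell_time hΩ hR
    (fun t h0 h1 => hr t h0 (EReal.coe_lt_coe_iff.1 h1)) hM'
  -- At most one reset fits in the last `δ` units of time; after it the solution is Lipschitz up to
  -- `T`.
  obtain ⟨a, ha0, haT, hno⟩ : ∃ a, 0 ≤ a ∧ a < T ∧
      ∀ t ∈ Ioo a T, ∀ z, IsLeftLimit x t z → z ∉ Ω := by
    by_cases h : ∃ a ∈ Ioo (max 0 (T - δ)) T, ∃ z ∈ Ω, IsLeftLimit x a z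
    · obtain ⟨a, ha, hres⟩ := h
      have ha0 : 0 < a := (le_max_left _ _).trans_lt ha.1
      have ha1 : T - δ < a := (le_max_right _ _).trans_lt ha.1
      refine ⟨a, ha0.le, ha.2, fun t ht z hz hzΩ => ?_⟩
      have := hdwell a t ha0 ht.1 (EReal.coe_lt_coe_iff.2 ht.2) hres ⟨z, hzΩ, hz⟩
      linarith [ht.2]
    · push Not at h
      exact ⟨max 0 (T - δ), le_max_left _ _, max_lt hT (by linarith),
        fun t ht z hz hzΩ => h t ht z hzΩ hz⟩
  have hM0 : 0 ≤ M := (norm_nonneg _).trans (hM 0 le_rfl hT)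
  have hle : ∀ s ∈ Ico a T, ∀ t ∈ Ico a T, s ≤ t → ‖x t - x s‖ ≤ M * (t - s) :=
    fun s hs t ht hst => hx.norm_sub_le hM' (ha0.trans hs.1) hst (EReal.coe_lt_coe_iff.2 ht.2)
      fun τ hτ => hno τ ⟨hs.1.trans_lt hτ.1, hτ.2.trans_lt ht.2⟩
  have hlip : LipschitzOnWith (NNReal.mk M hM0) x (Ico a T) := by
    refine LipschitzOnWith.of_dist_le_mul fun s hs t ht => ?_
    rw [NNReal.coe_mk, Real.dist_eq]
    rcases le_total s t with hst | hst
    · rw [dist_comm, dist_eq_norm, abs_sub_comm, abs_of_nonneg (sub_nonneg.2 hst)]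
      exact hle s hs t ht hst
    · rw [dist_eq_norm, abs_of_nonneg (sub_nonneg.2 hst)]
      exact hle t ht s hs hst
  -- The left limit is the value at `T` of a Lipschitz extension to the whole line.
  obtain ⟨g, hg, heq⟩ := hlip.extend_pi
  refine ⟨g T, IsLeftLimit.congr haT heq.symm ?_⟩
  exact (hg.continuous.tendsto T).mono_left nhdsWithin_le_nhds

/-- The integral equation persists up to the end of the interval of definition. -/
theorem flow_end (hx : IsSolution f R Ω x₀ T x) {M : ℝ}
    (hM : ∀ t : ℝ, 0 ≤ t → t < T → ‖f (x t)‖ ≤ M) {z : Vec n} (hz : IsLeftLimit x T z)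
    {a : ℝ} (ha : 0 ≤ a) (haT : a < T) (hno : ∀ t ∈ Ioo a T, ∀ z, IsLeftLimit x t z → z ∉ Ω) :
    IntervalIntegrable (fun τ => f (x τ)) volume a T ∧ z = x a + ∫ τ in a..T, f (x τ) := by
  have hflow : ∀ b ∈ Ico a T, IntervalIntegrable (fun τ => f (x τ)) volume a b ∧
      x b = x a + ∫ τ in a..b, f (x τ) := fun b hb =>
    hx.flow a b ha hb.1 (EReal.coe_lt_coe_iff.2 hb.2) fun s hs => hno s ⟨hs.1, hs.2.trans_lt hb.2⟩
  have hM0 : 0 ≤ M := (norm_nonneg _).trans (hM a ha haT)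
  have hint : IntervalIntegrable (fun τ => f (x τ)) volume a T := by
    rw [intervalIntegrable_iff_integrableOn_Ioc_of_le haT.le]
    obtain ⟨u, -, hu, hlim⟩ := exists_seq_strictMono_tendsto' haT
    refine integrableOn_Ioc_of_intervalIntegral_norm_bounded_right (l := atTop) (b := u)
      (I := M * (T - a)) (fun i => ?_) hlim (Eventually.of_forall fun i => ?_)
    · exact (hflow (u i) ⟨(hu i).1.le, (hu i).2⟩).1.1
    · have hle : ∀ τ ∈ Ioc a (u i), ‖‖f (x τ)‖‖ ≤ M := fun τ hτ => by
        rw [norm_norm]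
        exact hM τ (ha.trans hτ.1.le) (hτ.2.trans_lt (hu i).2)
      rw [← intervalIntegral.integral_of_le (hu i).1.le]
      refine (le_abs_self _).trans ?_
      have := intervalIntegral.norm_integral_le_of_norm_le_const (a := a) (b := u i)
        (f := fun τ => ‖f (x τ)‖) (C := M) (by rwa [uIoc_of_le (hu i).1.le])
      refine this.trans ?_
      rw [abs_of_nonneg (sub_nonneg.2 (hu i).1.le)]
      gcongr
      exact (hu i).2.le
  refine ⟨hint, ?_⟩
  have hprim : Tendsto (fun b => ∫ τ in a..b, f (x τ)) (𝓝[<] T) (𝓝 (∫ τ in a..T, f (x τ))) := by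
    have hc := intervalIntegral.continuousOn_primitive_interval' hint (left_mem_uIcc)
    have := (hc T right_mem_uIcc).tendsto
    refine this.mono_left ?_
    rw [uIcc_of_le haT.le, ← nhdsWithin_Ico_eq_nhdsLT haT]
    exact nhdsWithin_mono _ Ico_subset_Icc_self
  refine tendsto_nhds_unique hz ((hprim.const_add (x a)).congr' ?_)
  filter_upwards [Ico_mem_nhdsLT haT] with b hb using (hflow b hb).2.symm

/-- Concatenation of solutions. -/
theorem concat (hx : IsSolution f R Ω x₀ T x) {M : ℝ}
    (hM : ∀ t : ℝ, 0 ≤ t → t < T → ‖f (x t)‖ ≤ M) {z : Vec n} (hz : IsLeftLimit x T z)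
    {w : Vec n} {T' : ℝ} {y : ℝ → Vec n} (hy : IsSolution f R Ω w T' y)
    (hreset : z ∈ Ω → y 0 = R *ᵥ z) (hcont : z ∉ Ω → y 0 = z) :
    IsSolution f R Ω x₀ ((T + T' : ℝ) : EReal) fun t => if t < T then x t else y (t - T) := by
  have hT : 0 < T := by exact_mod_cast hx.pos
  have hT' : 0 < T' := by exact_mod_cast hy.pos
  set c : ℝ → Vec n := fun t => if t < T then x t else y (t - T) with hc
  have hcx : ∀ t, t < T → c t = x t := fun t ht => if_pos ht
  have hcy : ∀ t, T ≤ t → c t = y (t - T) := fun t ht => if_neg (not_lt.2 ht)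
  have hlx : ∀ t w, 0 < t → t ≤ T → IsLeftLimit x t w → IsLeftLimit c t w := fun t w h0 h1 h =>
    h.congr h0 fun τ hτ => (hcx τ (hτ.2.trans_le h1)).symm
  have hflowy : ∀ a b : ℝ, T ≤ a → a ≤ b → b < T + T' →
      (∀ t ∈ Ioc a b, ∀ z, IsLeftLimit c t z → z ∉ Ω) →
      IntervalIntegrable (fun τ => f (c τ)) volume a b ∧ c b = c a + ∫ τ in a..b, f (c τ) := by
    intro a b ha hab hb hno
    obtain ⟨h1, h2⟩ := hy.flow (a - T) (b - T) (by linarith) (by linarith)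
      (EReal.coe_lt_coe_iff.2 (by linarith)) fun t ht z hz => hno (t + T)
        ⟨by linarith [ht.1], by linarith [ht.2]⟩ z
        ((isLeftLimit_comp_sub_iff (by linarith [ht.1]) hcy).2 (by simpa using hz))
    have hcongr : ∀ τ ∈ uIcc a b, f (y (τ - T)) = f (c τ) := fun τ hτ => by
      rw [uIcc_of_le hab] at hτ
      rw [hcy τ (ha.trans hτ.1)]
    rw [hcy b (ha.trans hab), hcy a ha, ← intervalIntegral.integral_congr hcongr,
      intervalIntegral.integral_comp_sub_right (fun τ => f (y τ))]
    refine ⟨IntervalIntegrable.congr (fun τ hτ => hcongr τ (uIoc_subset_uIcc hτ)) ?_, h2⟩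
    simpa using h1.comp_sub_right T
  refine ⟨by exact_mod_cast add_pos hT hT', ?_, ?_, ?_, ?_⟩
  · rw [hcx 0 hT]
    exact hx.init
  · intro t ht htT
    have htT' : t < T + T' := EReal.coe_lt_coe_iff.1 htT
    rcases lt_or_ge t T with h | h
    · refine (hx.rightCont t ht (EReal.coe_lt_coe_iff.2 h)).congr_of_eventuallyEq ?_ (hcx t h)
      filter_upwards [nhdsWithin_le_nhds (Iio_mem_nhds h)] with τ hτ using hcx τ hτ
    · have h1 := hy.rightCont (t - T) (by linarith) (EReal.coe_lt_coe_iff.2 (by linarith))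
      have h2 : ContinuousWithinAt (fun τ => τ - T) (Ici t) t :=
        (continuous_sub_right T).continuousWithinAt
      have h3 : ContinuousWithinAt (y ∘ fun τ => τ - T) (Ici t) t :=
        ContinuousWithinAt.comp (t := Ici (t - T)) h1 h2 fun τ hτ => sub_le_sub_right hτ T
      exact h3.congr (fun τ hτ => hcy τ (h.trans hτ)) (hcy t h)
  · intro t ht htT
    have htT' : t < T + T' := EReal.coe_lt_coe_iff.1 htT
    rcases lt_trichotomy t T with h | rfl | h
    · obtain ⟨z, hz, h1⟩ := hx.jump t ht (EReal.coe_lt_coe_iff.2 h)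
      rw [hcx t h]
      exact ⟨z, hlx t z ht h.le hz, h1⟩
    · refine ⟨z, hlx t z ht le_rfl hz, ?_⟩
      rw [hcy t le_rfl, sub_self]
      exact ⟨hreset, hcont⟩
    · obtain ⟨z, hz, h1⟩ := hy.jump (t - T) (by linarith) (EReal.coe_lt_coe_iff.2 (by linarith))
      rw [hcy t h.le]
      exact ⟨z, (isLeftLimit_comp_sub_iff h hcy).2 hz, h1⟩
  · intro a b ha hab hb hno
    have hb' : b < T + T' := EReal.coe_lt_coe_iff.1 hb
    rcases le_or_gt T a with hTa | haT
    · exact hflowy a b hTa hab hb' hno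
    rcases lt_or_ge b T with hbT | hTb
    · obtain ⟨h1, h2⟩ := hx.flow a b ha hab (EReal.coe_lt_coe_iff.2 hbT) fun t ht w hw =>
        hno t ht w (hlx t w (ha.trans_lt ht.1) (ht.2.trans hbT.le) hw)
      have hcongr : ∀ τ ∈ uIcc a b, f (x τ) = f (c τ) := fun τ hτ => by
        rw [uIcc_of_le hab] at hτ
        rw [hcx τ (hτ.2.trans_lt hbT)]
      rw [hcx b hbT, hcx a haT, ← intervalIntegral.integral_congr hcongr]
      exact ⟨h1.congr fun τ hτ => hcongr τ (uIoc_subset_uIcc hτ), h2⟩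
    -- The interval straddles `T`. No reset at `T` means `z ∉ Ω`, so the second piece starts at `z`
    -- and the two integral equations add up; the integrands on the first piece differ at most at `τ
    -- = T`.
    · obtain ⟨h1, h2⟩ := hx.flow_end hM hz ha haT fun t ht w hw =>
        hno t ⟨ht.1, ht.2.le.trans hTb⟩ w (hlx t w (ha.trans_lt ht.1) ht.2.le hw)
      obtain ⟨h3, h4⟩ := hflowy T b le_rfl hTb hb' fun t ht => hno t ⟨haT.trans ht.1, ht.2⟩
      have hzΩ : z ∉ Ω := hno T ⟨haT, hTb⟩ z (hlx T z hT le_rfl hz)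
      have hcT : c T = z := by rw [hcy T le_rfl, sub_self, hcont hzΩ]
      have hae : ∀ᵐ τ : ℝ, τ ∈ uIoc a T → f (x τ) = f (c τ) := by
        have hne : ∀ᵐ τ : ℝ, τ ≠ T := by simp [ae_iff]
        filter_upwards [hne] with τ h1 h2
        rw [uIoc_of_le haT.le] at h2
        rw [hcx τ (lt_of_le_of_ne h2.2 h1)]
      have h1' : IntervalIntegrable (fun τ => f (c τ)) volume a T :=
        h1.congr_ae ((ae_restrict_iff' measurableSet_uIoc).2 hae)
      refine ⟨h1'.trans h3, ?_⟩
      rw [h4, hcT, h2, hcx a haT, ← intervalIntegral.integral_add_adjacent_intervals h1' h3,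
        intervalIntegral.integral_congr_ae hae, add_assoc]

end IsSolution

/-- Forward completeness from local existence and a priori bounds. -/
theorem forwardComplete_of_bounded {n : ℕ} {f : Vec n → Vec n} {R : Mat n n} {Ω : Set (Vec n)}
    (hΩ : IsClosed Ω) (hR : ∀ z ∈ Ω, R *ᵥ z ∉ Ω)
    (hlocal : ∀ w, w ∉ Ω → ∃ (ε : ℝ) (y : ℝ → Vec n), IsSolution f R Ω w ε y ∧ y 0 = w)
    (hbdd : ∀ (x₀ : Vec n) (T : ℝ) (x : ℝ → Vec n), IsSolution f R Ω x₀ T x →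
      ∃ r M : ℝ, ∀ t : ℝ, 0 ≤ t → t < T → ‖x t‖ ≤ r ∧ ‖f (x t)‖ ≤ M) :
    ForwardComplete f R Ω := by
  have hext : ∀ x₀ T x, IsSolution f R Ω x₀ T x →
      ∃ y, IsSolution f R Ω x₀ ⊤ y ∧ ∀ t : ℝ, 0 ≤ t → (t : EReal) < T → y t = x t := by
    intro x₀ T x hx
    -- Zorn's lemma for the extension order. Values outside the interval of definition are
    -- irrelevant, so this is only a preorder, and maximality is used only through its time
    -- component.
    let le : EReal × (ℝ → Vec n) → EReal × (ℝ → Vec n) → Prop := fun p q =>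
      p.1 ≤ q.1 ∧ ∀ t : ℝ, 0 ≤ t → (t : EReal) < p.1 → q.2 t = p.2 t
    have le_trans' : ∀ {p q r}, le p q → le q r → le p r := fun {p q r} h1 h2 =>
      ⟨h1.1.trans h2.1, fun t h0 ht => (h2.2 t h0 (ht.trans_le h1.1)).trans (h1.2 t h0 ht)⟩
    let E := {p : EReal × (ℝ → Vec n) // IsSolution f R Ω x₀ p.1 p.2 ∧ le (T, x) p}
    have : Nonempty E := ⟨⟨(T, x), hx, le_rfl, fun _ _ _ => rfl⟩⟩
    obtain ⟨⟨⟨T₁, y⟩, hy, hxy⟩, hmax⟩ := exists_maximal_of_nonempty_chains_bounded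
      (r := fun p q : E => le p.1 q.1) (by
        intro c hc hne
        classical
        have hagree : ∀ p ∈ c, ∀ q ∈ c, ∀ t : ℝ, 0 ≤ t → (t : EReal) < p.1.1 →
            (t : EReal) < q.1.1 → p.1.2 t = q.1.2 t := by
          intro p hp q hq t h0 h1 h2
          rcases eq_or_ne p q with rfl | hpq
          · rfl
          rcases hc hp hq hpq with h | h
          · exact (h.2 t h0 h1).symm
          · exact h.2 t h0 h2
        let S : EReal := sSup ((fun p : E => p.1.1) '' c)
        let z : ℝ → Vec n := fun t =>
          if h : ∃ p ∈ c, (t : EReal) < p.1.1 then h.choose.1.2 t else 0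
        have hz : ∀ p ∈ c, ∀ t : ℝ, 0 ≤ t → (t : EReal) < p.1.1 → z t = p.1.2 t := by
          intro p hp t h0 ht
          have h : ∃ p ∈ c, (t : EReal) < p.1.1 := ⟨p, hp, ht⟩
          simp only [z, dif_pos h]
          exact hagree _ h.choose_spec.1 p hp t h0 h.choose_spec.2 ht
        have hS : ∀ p ∈ c, p.1.1 ≤ S := fun p hp => le_sSup (mem_image_of_mem _ hp)
        obtain ⟨p₀, hp₀⟩ := hne
        have hsol : IsSolution f R Ω x₀ S z := by
          refine IsSolution.of_forall_exists_eqOn (p₀.2.1.pos.trans_le (hS p₀ hp₀)) ?_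
          intro b _ hb
          obtain ⟨_, ⟨p, hp, rfl⟩, hlt⟩ := lt_sSup_iff.1 hb
          exact ⟨p.1.1, p.1.2, hlt, p.2.1, hz p hp⟩
        exact ⟨⟨(S, z), hsol, le_trans' p₀.2.2 ⟨hS p₀ hp₀, hz p₀ hp₀⟩⟩,
          fun p hp => ⟨hS p hp, hz p hp⟩⟩) le_trans'
    simp only at hy
    induction T₁ with
    | top => exact ⟨y, hy, hxy.2⟩
    | bot => exact absurd hy.pos (by simp)
    | coe T₁ =>
      -- A maximal solution with finite end time has a left limit `z`; restarting from `z`, or from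
      -- `R z` if `z ∈ Ω`, extends it strictly.
      exfalso
      obtain ⟨r, M, hb⟩ := hbdd x₀ T₁ y hy
      have hM := fun t h0 h1 => (hb t h0 h1).2
      obtain ⟨z, hz⟩ := hy.exists_isLeftLimit_end hΩ hR (fun t h0 h1 => (hb t h0 h1).1) hM
      classical
      obtain ⟨ε, v, hv, hv0⟩ := hlocal (if z ∈ Ω then R *ᵥ z else z) (by
        split_ifs with h
        exacts [hR z h, h])
      have hcat := hy.concat hM hz hv (fun h => by rw [hv0, if_pos h]) fun h => by
        rw [hv0, if_neg h]
      have hε : 0 < ε := by exact_mod_cast hv.pos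
      have hlt : (T₁ : EReal) < ((T₁ + ε : ℝ) : EReal) := EReal.coe_lt_coe_iff.2 (by linarith)
      have hle : le (T₁, y) (((T₁ + ε : ℝ) : EReal), fun t => if t < T₁ then y t else v (t - T₁)) :=
        ⟨hlt.le, fun t _ ht => if_pos (EReal.coe_lt_coe_iff.1 ht)⟩
      exact absurd (hmax ⟨_, hcat, le_trans' hxy hle⟩ hle).1 (not_le.2 hlt)
  refine ⟨fun x₀ => ?_, hext⟩
  by_cases h0 : x₀ ∈ Ω
  -- Local solutions are available only off `Ω`, so `x₀` is read as `x⁻(0)` and reset at once.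
  · obtain ⟨ε, y, hy, hy0⟩ := hlocal (R *ᵥ x₀) (hR x₀ h0)
    have hy' : IsSolution f R Ω x₀ ε y := { hy with init := Or.inr ⟨h0, hy0⟩ }
    exact (hext _ _ _ hy').imp fun _ h => h.1
  · obtain ⟨ε, y, hy, -⟩ := hlocal x₀ h0
    exact (hext _ _ _ hy).imp fun _ h => h.1

/-! ### Homogeneous vector fields -/

/-- The field `f` is homogeneous of degree `μ` for the dilation generated by `G`, is linear with
matrix `H` on the unit sphere `xᵀ P x = 1`, and satisfies there the Lyapunov equation with decay
rate `ρ`. -/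
structure IsHomField {n : ℕ} (G P H : Mat n n) (μ ρ : ℝ) (f : Vec n → Vec n) : Prop extends
    IsMonotone G P where
  rho_pos : 0 < ρ
  lyap : P * H + Hᵀ * P = -(ρ • (P * G + Gᵀ * P))
  map_zero : f 0 = 0
  map_of_homNorm : ∀ x s, homNorm G P x = Real.exp s →
    f x = Real.exp (μ * s) • (dil G s *ᵥ (H *ᵥ (dil G (-s) *ᵥ x)))
  bounded : ∀ s : ℝ, ∃ M, ∀ x, homNorm G P x ≤ Real.exp s → ‖f x‖ ≤ M

/-- Existence of a local solution to the scalar equation `σ' = -ρ e^{μ σ}`. -/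
theorem exists_hasDerivAt_neg_mul_exp (μ ρ s₀ : ℝ) :
    ∃ ε > 0, ∃ σ : ℝ → ℝ, σ 0 = s₀ ∧
      ∀ t ∈ Ioo (-ε) ε, HasDerivAt σ (-(ρ * Real.exp (μ * σ t))) t := by
  rcases eq_or_ne μ 0 with rfl | hμ
  · refine ⟨1, one_pos, fun t => s₀ - t * ρ, by simp, fun t _ => ?_⟩
    simpa using ((hasDerivAt_id t).mul_const ρ).const_sub s₀
  -- For `μ ≠ 0` the equation says that `e^{-μσ}` is affine in time with slope `μρ`.
  · have hg : Continuous fun t => Real.exp (-(μ * s₀)) + t * (μ * ρ) := by fun_prop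
    have hev : ∀ᶠ t in 𝓝 (0 : ℝ), 0 < Real.exp (-(μ * s₀)) + t * (μ * ρ) :=
      hg.continuousAt.eventually_const_lt (by simp [Real.exp_pos])
    obtain ⟨ε, hε, hball⟩ := Metric.eventually_nhds_iff.1 hev
    refine ⟨ε, hε, fun t => -(Real.log (Real.exp (-(μ * s₀)) + t * (μ * ρ)) / μ), ?_,
      fun t ht => ?_⟩
    · simp only [zero_mul, add_zero, Real.log_exp]
      field_simp
    · have hpos := hball (y := t) (by rw [dist_zero_right]; exact abs_lt.2 ht)
      have hd := ((((hasDerivAt_id t).mul_const (μ * ρ)).const_add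
        (Real.exp (-(μ * s₀)))).log hpos.ne').div_const μ |>.neg
      convert! hd using 1
      have : μ * -(Real.log (Real.exp (-(μ * s₀)) + t * (μ * ρ)) / μ)
          = -Real.log (Real.exp (-(μ * s₀)) + t * (μ * ρ)) := by field_simp
      rw [this, Real.exp_neg, Real.exp_log hpos]
      simp only [id]
      field_simp

theorem isSolution_of_hasDerivAt {n : ℕ} {f : Vec n → Vec n} {R : Mat n n} {Ω : Set (Vec n)}
    {ε : ℝ} {x : ℝ → Vec n} (hε : 0 < ε)
    (hd : ∀ t ∈ Ico 0 ε, HasDerivAt x (f (x t)) t)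
    (hf : ContinuousOn (fun t => f (x t)) (Ico 0 ε)) (hΩ : ∀ t ∈ Ico 0 ε, x t ∉ Ω) :
    IsSolution f R Ω (x 0) ε x where
  pos := by exact_mod_cast hε
  init := Or.inl rfl
  rightCont := fun t ht htε =>
    (hd t ⟨ht, EReal.coe_lt_coe_iff.1 htε⟩).continuousAt.continuousWithinAt
  jump := fun t ht htε => by
    have hmem : t ∈ Ico 0 ε := ⟨ht.le, EReal.coe_lt_coe_iff.1 htε⟩
    exact ⟨x t, (hd t hmem).continuousAt.tendsto.mono_left nhdsWithin_le_nhds,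
      fun h => absurd h (hΩ t hmem), fun _ => rfl⟩
  flow := fun a b ha hab hb _ => by
    have hsub : uIcc a b ⊆ Ico 0 ε := by
      rw [uIcc_of_le hab]
      exact fun τ hτ => ⟨ha.trans hτ.1, hτ.2.trans_lt (EReal.coe_lt_coe_iff.1 hb)⟩
    have hint : IntervalIntegrable (fun τ => f (x τ)) volume a b :=
      (hf.mono hsub).intervalIntegrable
    refine ⟨hint, ?_⟩
    rw [intervalIntegral.integral_eq_sub_of_hasDerivAt (fun t ht => hd t (hsub ht)) hint]
    abel

namespace IsHomField

variable {n : ℕ} {G P H : Mat n n} {μ ρ : ℝ} {f : Vec n → Vec n}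

/-- Away from `0` the field is a jointly continuous expression in `(ln ‖x‖_d, x)`. -/
theorem continuousAt (h : IsHomField G P H μ ρ f) {x : Vec n} (hx : x ≠ 0) : ContinuousAt f x := by
  have hlog := h.toIsMonotone.continuousAt_log_homNorm hx
  set L : Vec n → ℝ := fun y => Real.log (homNorm G P y) with hL
  have hmulVec : Continuous fun y : Vec n => H *ᵥ y := continuous_const.matrix_mulVec continuous_id
  have hfun : Continuous fun p : ℝ × Vec n =>
      Real.exp (μ * p.1) • (dil G p.1 *ᵥ (H *ᵥ (dil G (-p.1) *ᵥ p.2))) := by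
    have h1 : Continuous fun p : ℝ × Vec n => dil G (-p.1) *ᵥ p.2 :=
      (continuous_dil_mulVec G).comp (continuous_fst.neg.prodMk continuous_snd)
    have h2 : Continuous fun p : ℝ × Vec n => dil G p.1 *ᵥ (H *ᵥ (dil G (-p.1) *ᵥ p.2)) :=
      (continuous_dil_mulVec G).comp (continuous_fst.prodMk (hmulVec.comp h1))
    exact (continuous_const.mul continuous_fst).rexp.smul h2
  have hpair : ContinuousAt (fun y => (L y, y)) x := hlog.prodMk continuousAt_id
  have hmain := ContinuousAt.comp (f := fun y => (L y, y)) hfun.continuousAt hpair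
  refine hmain.congr ?_
  filter_upwards [isOpen_ne.mem_nhds hx] with y hy
  exact (h.map_of_homNorm y (L y) (Real.exp_log (IsMonotone.homNorm_pos hy)).symm).symm

/-- The decay term is absorbed by `ρG`: the exponential of `H + ρG` preserves the unit `P`-sphere,
which makes the explicit flow possible. -/
theorem lyap_add_smul (h : IsHomField G P H μ ρ f) : P * (H + ρ • G) + (H + ρ • G)ᵀ * P = 0 := by
  have h1 := h.lyap
  rw [smul_add] at h1
  rw [transpose_add, transpose_smul, mul_add, add_mul, mul_smul_comm, smul_mul_assoc,
    add_add_add_comm, h1]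
  abel

/-- Away from the origin the flow of `f` is explicit: `x(t) = d(σ) exp(τ M) d(-s₀) w`, where
`M = H + ρ G`, `σ' = -ρ e^{μ σ}` and `τ = (s₀ - σ) / ρ`. -/
theorem exists_hasDerivAt (h : IsHomField G P H μ ρ f) {w : Vec n} (hw : w ≠ 0) :
    ∃ ε > 0, ∃ x : ℝ → Vec n, x 0 = w ∧
      ∀ t ∈ Ioo (-ε) ε, x t ≠ 0 ∧ HasDerivAt x (f (x t)) t := by
  set s₀ := Real.log (homNorm G P w) with hs₀
  obtain ⟨ε, hε, σ, hσ0, hσ⟩ := exists_hasDerivAt_neg_mul_exp μ ρ s₀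
  set v := dil G (-s₀) *ᵥ w with hv
  set y : ℝ → Vec n := fun t => dil (H + ρ • G) ((s₀ - σ t) / ρ) *ᵥ v with hy
  have hqv : qform P v = 1 := h.qform_dil_log_homNorm hw
  have hqy : ∀ t, qform P (y t) = 1 := fun t => by
    rw [hy, qform_dil_eq h.lyap_add_smul, hqv]
  have hy0 : ∀ t, y t ≠ 0 := fun t h0 => by
    have := hqy t
    rw [h0, qform_zero] at this
    exact zero_ne_one this
  refine ⟨ε, hε, fun t => dil G (σ t) *ᵥ y t, ?_, fun t ht =>
    ⟨dil_mulVec_ne_zero G _ (hy0 t), ?_⟩⟩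
  · simp only [hy, hσ0, sub_self, zero_div, dil_zero, one_mulVec, hv, dil_mulVec_dil_neg_mulVec]
  · have hf : f (dil G (σ t) *ᵥ y t) = Real.exp (μ * σ t) • (dil G (σ t) *ᵥ (H *ᵥ y t)) := by
      have := h.map_of_homNorm (dil G (σ t) *ᵥ y t) (σ t)
        (h.homNorm_eq_exp_of_qform (by rw [dil_neg_mulVec_dil_mulVec, hqy]))
      rwa [dil_neg_mulVec_dil_mulVec] at this
    have hσt := (hσ t ht).hasDerivWithinAt (s := univ)
    have hdy := hasDerivWithinAt_dil_mulVec (G := H + ρ • G) ((hσt.const_sub s₀).div_const ρ)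
      (hasDerivWithinAt_const t univ v)
    have hd := hasDerivWithinAt_univ.1 (hasDerivWithinAt_dil_mulVec (G := G) hσt hdy)
    -- The derivative is `d(σ)(σ'Gy + e^{μσ}(H + ρG)y)`; the two `G` terms cancel because `σ' =
    -- -ρe^{μσ}`.
    rw [hf]
    convert! hd using 1
    have hyM : dil (H + ρ • G) ((s₀ - σ t) / ρ) *ᵥ ((H + ρ • G) *ᵥ v)
        = (H + ρ • G) *ᵥ y t := by
      rw [mulVec_mulVec, dil_commute, ← mulVec_mulVec]
    have hcoef : - -(ρ * Real.exp (μ * σ t)) / ρ = Real.exp (μ * σ t) := by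
      rw [neg_neg, mul_div_cancel_left₀ _ h.rho_pos.ne']
    rw [hcoef, add_zero, mulVec_smul, hyM, ← mulVec_smul]
    congr 1
    change _ = -(ρ * Real.exp (μ * σ t)) • (G *ᵥ y t) + _
    rw [add_mulVec, smul_mulVec, smul_add, smul_smul]
    module

theorem exists_isSolution (h : IsHomField G P H μ ρ f)
    (R : Mat n n) {Ω : Set (Vec n)} (hΩ : IsClosed Ω) {w : Vec n}
    (hw : w ∉ Ω) : ∃ (ε : ℝ) (x : ℝ → Vec n), IsSolution f R Ω w ε x ∧ x 0 = w := by
  rcases eq_or_ne w 0 with rfl | hw0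
  · refine ⟨1, fun _ => 0, ?_, rfl⟩
    refine isSolution_of_hasDerivAt (x := fun _ => 0) one_pos (fun t _ => ?_) continuousOn_const
      fun _ _ => hw
    simpa [h.map_zero] using hasDerivAt_const t (0 : Vec n)
  · obtain ⟨ε, hε, x, rfl, hx⟩ := h.exists_hasDerivAt hw0
    have h0 : (0 : ℝ) ∈ Ioo (-ε) ε := ⟨by linarith, hε⟩
    have hev : ∀ᶠ t in 𝓝 (0 : ℝ), x t ∉ Ω :=
      (hx 0 h0).2.continuousAt.eventually (hΩ.isOpen_compl.mem_nhds hw)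
    obtain ⟨δ, hδ, hball⟩ := Metric.eventually_nhds_iff.1 hev
    have hmem : ∀ t ∈ Ico 0 (min ε δ), t ∈ Ioo (-ε) ε := fun t ht =>
      ⟨by linarith [ht.1], ht.2.trans_le (min_le_left _ _)⟩
    refine ⟨min ε δ, x, isSolution_of_hasDerivAt (lt_min hε hδ) (fun t ht => (hx t (hmem t ht)).2)
      (fun t ht => ?_) (fun t ht => hball ?_), rfl⟩
    · obtain ⟨h1, h2⟩ := hx t (hmem t ht)
      exact (ContinuousAt.comp (g := f) (h.continuousAt h1) h2.continuousAt).continuousWithinAt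
    · rw [dist_zero_right, Real.norm_of_nonneg ht.1]
      exact ht.2.trans_le (min_le_right _ _)

/-- With `a = σ'` and `b = e^{μσ}` this is the derivative of `q(d(-σ)x)` where it equals `1`. The
Lyapunov equation makes it `-(a + ρb)` times a positive definite form. -/
theorem dotProduct_add_neg (h : IsHomField G P H μ ρ f)
    {v : Vec n} {a b : ℝ} (hab : -(ρ * b) < a) (hv : v ≠ 0) :
    ((-a • G + b • H) *ᵥ v) ⬝ᵥ (P *ᵥ v) + v ⬝ᵥ (P *ᵥ ((-a • G + b • H) *ᵥ v)) < 0 := by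
  have h1 : P * (-a • G + b • H) + (-a • G + b • H)ᵀ * P
      = -a • (P * G + Gᵀ * P) + b • (P * H + Hᵀ * P) := by
    simp only [transpose_add, transpose_smul, mul_add, add_mul, mul_smul_comm, smul_mul_assoc,
      smul_add]
    abel
  have h2 : P * (-a • G + b • H) + (-a • G + b • H)ᵀ * P
      = (-(a + ρ * b)) • (P * G + Gᵀ * P) := by
    rw [h1, h.lyap]
    module
  rw [dotProduct_mulVec_add_eq_qform, h2, qform, smul_mulVec, dotProduct_smul, smul_eq_mul]
  exact mul_neg_of_neg_of_pos (by linarith) (qform_pos h.posDef_lyap hv)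

variable {R : Mat n n} {Ω : Set (Vec n)}

/-! ### Decay of the homogeneous norm along solutions -/

section Decay

variable {x₀ : Vec n} {T : EReal} {x : ℝ → Vec n}

/-- Comparison principle: a strict supersolution `σ` of `σ' = -ρ e^{μ σ}` that dominates the
logarithm of the homogeneous norm at time `0` does so as long as both are defined. -/
theorem homNorm_le_exp_of_supersolution (h : IsHomField G P H μ ρ f) (hΩ : IsClosed Ω)
    (hR : ∀ z ∈ Ω, R *ᵥ z ∉ Ω) (hle : ∀ z ∈ Ω, homNorm G P (R *ᵥ z) ≤ homNorm G P z)
    (hx : IsSolution f R Ω x₀ T x) {b : ℝ} (hb : 0 ≤ b) (hbT : (b : EReal) < T)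
    {σ σ' : ℝ → ℝ} (hσ : ∀ t ∈ Icc 0 b, HasDerivAt σ (σ' t) t)
    (hlt : ∀ t ∈ Icc 0 b, -(ρ * Real.exp (μ * σ t)) < σ' t)
    (h0 : homNorm G P x₀ ≤ Real.exp (σ 0)) : homNorm G P (x b) ≤ Real.exp (σ b) := by
  set W : ℝ → ℝ := fun t => qform P (dil G (-σ t) *ᵥ x t) with hW
  have hWle : ∀ t, W t ≤ 1 ↔ homNorm G P (x t) ≤ Real.exp (σ t) := fun t =>
    h.homNorm_le_exp_iff.symm
  have hT : ∀ t ∈ Icc 0 b, (t : EReal) < T := fun t ht =>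
    (EReal.coe_le_coe_iff.2 ht.2).trans_lt hbT
  have hq : Continuous fun p : ℝ × Vec n => qform P (dil G p.1 *ᵥ p.2) :=
    (continuous_qform P).comp (continuous_dil_mulVec G)
  have hWlim : ∀ t ∈ Icc 0 b, ∀ (l : Filter ℝ) (z : Vec n), l ≤ 𝓝 t → Tendsto x l (𝓝 z) →
      Tendsto W l (𝓝 (qform P (dil G (-σ t) *ᵥ z))) := fun t ht l z hl hz =>
    Tendsto.comp (f := fun τ => (-σ τ, x τ)) (hq.tendsto (-σ t, z))
      (((hσ t ht).continuousAt.neg.tendsto.mono_left hl).prodMk_nhds hz)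
  have hWright : ∀ t ∈ Icc 0 b, Tendsto W (𝓝[≥] t) (𝓝 (W t)) := fun t ht =>
    hWlim t ht _ _ nhdsWithin_le_nhds (hx.rightCont t ht.1 (hT t ht))
  -- If `W t > 1`, then `W > 1` nearby: on the right by right continuity, on the left because the
  -- left limit must exceed `1` too, a reset never raising the homogeneous norm.
  have hclosed : IsClosed ({t | W t ≤ 1} ∩ Icc 0 b) := by
    rw [← isOpen_compl_iff, isOpen_iff_mem_nhds]
    intro t ht
    by_cases htb : t ∈ Icc 0 b
    · have hWt : 1 < W t := not_le.1 fun hle1 => ht ⟨hle1, htb⟩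
      rw [← nhdsLT_sup_nhdsGE t]
      refine mem_sup.2 ⟨?_, ?_⟩
      · rcases htb.1.eq_or_lt with rfl | hpos
        · filter_upwards [self_mem_nhdsWithin] with τ hτ hmem
          exact absurd hmem.2.1 (not_le.2 hτ)
        · obtain ⟨z, hz, hzΩ, hzn⟩ := hx.jump t hpos (hT t htb)
          have hlim : 1 < qform P (dil G (-σ t) *ᵥ z) := by
            refine not_le.1 fun hle1 => not_le.2 hWt ((hWle t).2 ?_)
            have hzle := h.homNorm_le_exp_iff.2 hle1
            by_cases hmem : z ∈ Ω
            · rw [hzΩ hmem]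
              exact (hle z hmem).trans hzle
            · rwa [hzn hmem]
          filter_upwards [(hWlim t htb _ z nhdsWithin_le_nhds hz).eventually_const_lt hlim]
            with τ hτ hmem using absurd hmem.1 (not_le.2 hτ)
      · filter_upwards [(hWright t htb).eventually_const_lt hWt] with τ hτ hmem
          using absurd hmem.1 (not_le.2 hτ)
    · filter_upwards [isClosed_Icc.isOpen_compl.mem_nhds htb] with τ hτ hmem using hτ hmem.2
  have hinit : (0 : ℝ) ∈ {t | W t ≤ 1} := by
    refine (hWle 0).2 ?_
    rcases hx.init with hi | ⟨hmem, hi⟩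
    · rwa [hi]
    · rw [hi]
      exact (hle _ hmem).trans h0
  refine (hWle b).1 (hclosed.Icc_subset_of_forall_exists_gt hinit ?_ (right_mem_Icc.2 hb))
  rintro t ⟨htW : W t ≤ 1, ht⟩ y hy
  have htb : t ∈ Icc 0 b := Ico_subset_Icc_self ht
  have hgt : 𝓝[>] t ≤ 𝓝[≥] t := nhdsWithin_mono _ Ioi_subset_Ici_self
  -- Continuous induction on `[0, b]`. Only contact points `W t = 1` matter; there the strict
  -- supersolution inequality makes the right derivative of `W` negative.
  suffices hev : ∀ᶠ τ in 𝓝[>] t, W τ ≤ 1 by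
    exact (hev.and (Ioc_mem_nhdsGT hy)).exists
  rcases htW.lt_or_eq with hWlt | hWeq
  · filter_upwards [((hWright t htb).mono_left hgt).eventually_lt_const hWlt] with τ hτ using hτ.le
  · have hxt : x t ≠ 0 := by
      intro h0
      simp [hW, h0, qform_zero] at hWeq
    have hdx := hx.hasDerivWithinAt_Ici hΩ hR ht.1 (hT t htb) (h.continuousAt hxt)
    set v := dil G (-σ t) *ᵥ x t with hv
    have hfx : f (x t) = Real.exp (μ * σ t) • (dil G (σ t) *ᵥ (H *ᵥ v)) :=
      h.map_of_homNorm _ _ (h.homNorm_eq_exp_of_qform hWeq)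
    have hdv : HasDerivWithinAt (fun τ => dil G (-σ τ) *ᵥ x τ)
        ((-σ' t • G + Real.exp (μ * σ t) • H) *ᵥ v) (Ici t) t := by
      have hd := hasDerivWithinAt_dil_mulVec (G := G) (σ := fun τ => -σ τ)
        (hσ t htb).hasDerivWithinAt.neg hdx
      convert! hd using 1
      have hGv : dil G (-σ t) *ᵥ (G *ᵥ x t) = G *ᵥ v := by
        rw [mulVec_mulVec, dil_commute, ← mulVec_mulVec]
      rw [hfx, mulVec_add, mulVec_smul, mulVec_smul, dil_neg_mulVec_dil_mulVec, hGv,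
        add_mulVec, smul_mulVec, smul_mulVec]
    have hdW : HasDerivWithinAt W _ (Ici t) t := hasDerivWithinAt_qform (P := P) hdv
    have hneg := h.dotProduct_add_neg (v := v) (hlt t htb) (dil_mulVec_ne_zero G _ hxt)
    have hslope := (hasDerivWithinAt_iff_tendsto_slope' (lt_irrefl t)).1
      (hdW.mono Ioi_subset_Ici_self)
    filter_upwards [hslope.eventually_lt_const hneg, self_mem_nhdsWithin] with τ h1 h2
    rw [slope_def_field, div_neg_iff] at h1
    have hτt : 0 < τ - t := sub_pos.2 h2
    change W τ ≤ 1
    rcases h1 with h1 | h1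
    · linarith [h1.2]
    · have : W τ - W t < 0 := h1.1
      linarith

/-- Constants are strict supersolutions because `ρ > 0`. -/
theorem homNorm_le_exp (h : IsHomField G P H μ ρ f) (hΩ : IsClosed Ω) (hR : ∀ z ∈ Ω, R *ᵥ z ∉ Ω)
    (hle : ∀ z ∈ Ω, homNorm G P (R *ᵥ z) ≤ homNorm G P z) (hx : IsSolution f R Ω x₀ T x)
    {s t : ℝ} (hs : homNorm G P x₀ ≤ Real.exp s) (ht : 0 ≤ t)
    (htT : (t : EReal) < T) : homNorm G P (x t) ≤ Real.exp s :=
  h.homNorm_le_exp_of_supersolution hΩ hR hle hx ht htT (σ := fun _ => s) (σ' := fun _ => 0)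
    (fun t _ => hasDerivAt_const t s)
    (fun _ _ => neg_neg_of_pos (mul_pos h.rho_pos (Real.exp_pos _))) hs

/-- The comparison function solves `σ' = -ke^{μσ}` with `c = e^{-μσ(0)}`; it is a strict
supersolution since `k < ρ`. -/
theorem homNorm_le_exp_log_div (h : IsHomField G P H μ ρ f) (hΩ : IsClosed Ω)
    (hR : ∀ z ∈ Ω, R *ᵥ z ∉ Ω) (hle : ∀ z ∈ Ω, homNorm G P (R *ᵥ z) ≤ homNorm G P z)
    (hx : IsSolution f R Ω x₀ T x) {c k t : ℝ} (hμ : μ ≠ 0) (hk : k < ρ) (hc : 0 < c)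
    (hct : 0 < c + t * (μ * k)) (hs : homNorm G P x₀ ≤ Real.exp (-(Real.log c / μ))) (ht : 0 ≤ t)
    (htT : (t : EReal) < T) :
    homNorm G P (x t) ≤ Real.exp (-(Real.log (c + t * (μ * k)) / μ)) := by
  -- An affine function positive at both ends is positive in between.
  have hpos : ∀ τ ∈ Icc 0 t, 0 < c + τ * (μ * k) := fun τ hτ => by
    rcases le_total 0 (μ * k) with h1 | h1
    · have := mul_nonneg hτ.1 h1
      linarith
    · have := mul_le_mul_of_nonpos_right hτ.2 h1
      linarith
  refine h.homNorm_le_exp_of_supersolution hΩ hR hle hx ht htT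
    (σ := fun τ => -(Real.log (c + τ * (μ * k)) / μ))
    (σ' := fun τ => -((1 * (μ * k)) / (c + τ * (μ * k)) / μ)) (fun τ hτ => ?_) (fun τ hτ => ?_)
    (by simpa using hs)
  · exact (((((hasDerivAt_id τ).mul_const (μ * k)).const_add c).log
      (hpos τ hτ).ne').div_const μ).neg
  · have h1 : μ * -(Real.log (c + τ * (μ * k)) / μ) = -Real.log (c + τ * (μ * k)) := by
      field_simp
    have h2 := hpos τ hτ
    rw [h1, Real.exp_neg, Real.exp_log h2]
    have h3 : 1 * (μ * k) / (c + τ * (μ * k)) / μ = k * (c + τ * (μ * k))⁻¹ := by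
      field_simp
    rw [h3, neg_lt_neg_iff]
    exact mul_lt_mul_of_pos_right hk (inv_pos.2 h2)

/-- Finite settling time for negative degree. -/
theorem eq_zero_of_settling_le (h : IsHomField G P H μ ρ f) (hΩ : IsClosed Ω)
    (hR : ∀ z ∈ Ω, R *ᵥ z ∉ Ω) (hle : ∀ z ∈ Ω, homNorm G P (R *ᵥ z) ≤ homNorm G P z)
    (hx : IsSolution f R Ω x₀ T x) (hμ : μ < 0) {t : ℝ}
    (ht : (homNorm G P x₀) ^ (-μ) / (-(ρ * μ)) ≤ t) (htT : (t : EReal) < T) : x t = 0 := by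
  have hρμ : 0 < -(ρ * μ) := neg_pos.2 (mul_neg_of_pos_of_neg h.rho_pos hμ)
  have hN := IsMonotone.homNorm_nonneg (G := G) (P := P) x₀
  have hNt : (homNorm G P x₀) ^ (-μ) ≤ t * -(ρ * μ) := (div_le_iff₀ hρμ).1 ht
  have ht0 : 0 ≤ t := le_trans (div_nonneg (Real.rpow_nonneg hN _) hρμ.le) ht
  -- A homogeneous norm below every `e^s` forces `x t = 0`. For `t = 0` the hypothesis already gives
  -- `‖x₀‖_d = 0`.
  have hall : ∀ s : ℝ, homNorm G P (x t) ≤ Real.exp s := by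
    intro s
    rcases ht0.eq_or_lt with rfl | htpos
    · refine h.homNorm_le_exp hΩ hR hle hx ?_ le_rfl htT
      rcases hN.eq_or_lt with h0 | h0
      · rw [← h0]; exact (Real.exp_pos s).le
      · exact absurd (Real.rpow_pos_of_pos h0 (-μ)) (not_lt.2 (by simpa using hNt))
    · have hc : 0 < t * -(ρ * μ) := mul_pos htpos hρμ
      -- The start `c = -ρμt` dominates `‖x₀‖_d^{-μ}`, and `k` is tuned so that the comparison
      -- function equals `s` exactly at time `t`; `μ < 0` gives `k < ρ`.
      have hend : t * -(ρ * μ) + t * (μ * (ρ + Real.exp (-(μ * s)) / (μ * t)))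
          = Real.exp (-(μ * s)) := by
        have := hμ.ne
        field_simp
        ring
      have key := h.homNorm_le_exp_log_div hΩ hR hle hx (c := t * -(ρ * μ))
        (k := ρ + Real.exp (-(μ * s)) / (μ * t)) hμ.ne ?_ hc ?_ ?_ ht0 htT
      · rw [hend, Real.log_exp] at key
        convert key using 2
        have := hμ.ne
        field_simp
      · have : Real.exp (-(μ * s)) / (μ * t) < 0 :=
          div_neg_of_pos_of_neg (Real.exp_pos _) (mul_neg_of_neg_of_pos hμ htpos)
        linarith
      · rw [hend]; exact Real.exp_pos _
      · rcases hN.eq_or_lt with h0 | h0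
        · rw [← h0]; exact (Real.exp_pos _).le
        · rw [← Real.log_le_iff_le_exp h0, ← div_neg, le_div_iff₀ (neg_pos.2 hμ), mul_comm,
            ← Real.log_rpow h0]
          exact Real.log_le_log (Real.rpow_pos_of_pos h0 _) hNt
  by_contra hne
  have hp := IsMonotone.homNorm_pos (G := G) (P := P) hne
  have := (Real.log_le_iff_le_exp hp).2 (hall (Real.log (homNorm G P (x t)) - 1))
  linarith

/-- Exponential decay for degree zero. -/
theorem homNorm_le_exp_mul (h : IsHomField G P H μ ρ f) (hΩ : IsClosed Ω)
    (hR : ∀ z ∈ Ω, R *ᵥ z ∉ Ω) (hle : ∀ z ∈ Ω, homNorm G P (R *ᵥ z) ≤ homNorm G P z)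
    (hx : IsSolution f R Ω x₀ T x) (hμ : μ = 0) {t : ℝ} (ht : 0 ≤ t) (htT : (t : EReal) < T) :
    homNorm G P (x t) ≤ Real.exp (-ρ * t) * homNorm G P x₀ := by
  have hbound : ∀ s, homNorm G P x₀ ≤ Real.exp s →
      homNorm G P (x t) ≤ Real.exp (s - t * ρ) := by
    intro s hs
    have hcont : Continuous fun k => Real.exp (s - t * k) := by fun_prop
    -- The rate `ρ` itself is not strict, so it is reached as the limit of rates `k < ρ`.
    refine ge_of_tendsto (x := 𝓝[<] ρ) ((hcont.tendsto ρ).mono_left nhdsWithin_le_nhds) ?_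
    filter_upwards [self_mem_nhdsWithin] with k hk
    refine h.homNorm_le_exp_of_supersolution hΩ hR hle hx ht htT (σ := fun τ => s - τ * k)
      (σ' := fun _ => -(1 * k)) (fun τ _ => ((hasDerivAt_id τ).mul_const k).const_sub s)
      (fun τ _ => ?_) (by simpa using hs)
    rw [hμ, zero_mul, Real.exp_zero]
    have : k < ρ := hk
    linarith
  rcases (IsMonotone.homNorm_nonneg (G := G) (P := P) x₀).eq_or_lt with h0 | h0
  · rw [← h0, mul_zero]
    refine ge_of_tendsto Real.tendsto_exp_atBot (Eventually.of_forall fun s => ?_)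
    exact h.homNorm_le_exp hΩ hR hle hx (by rw [← h0]; exact (Real.exp_pos s).le) ht htT
  · have := hbound _ (Real.exp_log h0).ge
    rwa [sub_eq_neg_add, Real.exp_add, Real.exp_log h0, mul_comm t, ← neg_mul] at this

/-- Entry time into homogeneous balls for positive degree, independent of the initial state. -/
theorem homNorm_le_of_entry_le (h : IsHomField G P H μ ρ f) (hΩ : IsClosed Ω)
    (hR : ∀ z ∈ Ω, R *ᵥ z ∉ Ω) (hle : ∀ z ∈ Ω, homNorm G P (R *ᵥ z) ≤ homNorm G P z)
    (hx : IsSolution f R Ω x₀ T x) (hμ : 0 < μ) {r t : ℝ} (hr : 0 < r)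
    (ht : 1 / (ρ * μ * r ^ μ) ≤ t) (htT : (t : EReal) < T) : homNorm G P (x t) ≤ r := by
  have hρ := h.rho_pos
  have hrμ : 0 < r ^ μ := Real.rpow_pos_of_pos hr μ
  have htpos : 0 < t := lt_of_lt_of_le (by positivity) ht
  set N := homNorm G P x₀ with hN
  -- The comparison starts at `σ(0) = N`, admissible since `N ≤ e^N` even for `N = 0`. The choice of
  -- `k` makes `c + tμk = μρt`, the value at time `t` of the exact solution issued from `+∞`, which
  -- no longer depends on `x₀`.
  have hend : Real.exp (-(μ * N)) + t * (μ * (ρ - Real.exp (-(μ * N)) / (μ * t)))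
      = μ * ρ * t := by
    field_simp
    ring
  have key := h.homNorm_le_exp_log_div hΩ hR hle hx (c := Real.exp (-(μ * N)))
    (k := ρ - Real.exp (-(μ * N)) / (μ * t)) hμ.ne'
    (sub_lt_self _ (div_pos (Real.exp_pos _) (mul_pos hμ htpos))) (Real.exp_pos _)
    (by rw [hend]; positivity) ?_ htpos.le htT
  · refine key.trans ?_
    rw [hend, ← Real.le_log_iff_exp_le hr, neg_le, ← neg_le_neg_iff, neg_neg, ← neg_div,
      div_le_iff₀ hμ, neg_le, mul_comm (Real.log r), ← Real.log_rpow hr,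
      ← Real.log_inv]
    refine Real.log_le_log (inv_pos.2 hrμ) ?_
    rw [div_le_iff₀ (by positivity)] at ht
    rw [inv_le_iff_one_le_mul₀ hrμ]
    linarith
  · rw [Real.log_exp]
    have : -(-(μ * N) / μ) = N := by field_simp
    rw [this]
    linarith [Real.add_one_le_exp N]

end Decay

/-! ### Stability -/

theorem forwardComplete (h : IsHomField G P H μ ρ f) (hΩ : IsClosed Ω) (hR : ∀ z ∈ Ω, R *ᵥ z ∉ Ω)
    (hle : ∀ z ∈ Ω, homNorm G P (R *ᵥ z) ≤ homNorm G P z) : ForwardComplete f R Ω := by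
  refine forwardComplete_of_bounded hΩ hR (fun w hw => h.exists_isSolution R hΩ hw)
    fun x₀ T x hx => ?_
  have h0 : homNorm G P x₀ ≤ Real.exp (homNorm G P x₀) := by
    linarith [Real.add_one_le_exp (homNorm G P x₀)]
  obtain ⟨r, -, hr⟩ := h.exists_homNorm_le_imp_norm_le_const (homNorm G P x₀)
  obtain ⟨M, hM⟩ := h.bounded (homNorm G P x₀)
  refine ⟨r, M, fun t ht htT => ?_⟩
  have := h.homNorm_le_exp hΩ hR hle hx h0 ht (EReal.coe_lt_coe_iff.2 htT)
  exact ⟨hr _ this, hM _ this⟩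

theorem lyapunovStable (h : IsHomField G P H μ ρ f) (hΩ : IsClosed Ω) (hR : ∀ z ∈ Ω, R *ᵥ z ∉ Ω)
    (hle : ∀ z ∈ Ω, homNorm G P (R *ᵥ z) ≤ homNorm G P z) : LyapunovStable f R Ω := by
  intro ε hε
  obtain ⟨s, hs⟩ := h.exists_homNorm_le_imp_enorm₂_lt hε
  obtain ⟨δ, hδ, hδs⟩ := h.exists_enorm₂_lt_imp_homNorm_le s
  exact ⟨δ, hδ, fun x₀ T x hx hx₀ t ht htT =>
    hs _ (h.homNorm_le_exp hΩ hR hle hx (hδs x₀ hx₀) ht htT)⟩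

theorem finiteTimeStable (h : IsHomField G P H μ ρ f) (hΩ : IsClosed Ω) (hR : ∀ z ∈ Ω, R *ᵥ z ∉ Ω)
    (hle : ∀ z ∈ Ω, homNorm G P (R *ᵥ z) ≤ homNorm G P z)
    (hμ : μ < 0) : FiniteTimeStable f R Ω := by
  refine ⟨h.lyapunovStable hΩ hR hle, fun x₀ => (homNorm G P x₀) ^ (-μ) / (-(ρ * μ)),
    fun r => ?_, fun x₀ T x hx t _ hSt htT => h.eq_zero_of_settling_le hΩ hR hle hx hμ hSt htT⟩
  obtain ⟨s, hs⟩ := h.exists_enorm₂_le_imp_homNorm_le r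
  refine ⟨(Real.exp s) ^ (-μ) / (-(ρ * μ)), ?_⟩
  rintro _ ⟨x₀, hx₀, rfl⟩
  have hρμ : 0 < -(ρ * μ) := neg_pos.2 (mul_neg_of_pos_of_neg h.rho_pos hμ)
  exact div_le_div_of_nonneg_right
    (Real.rpow_le_rpow (IsMonotone.homNorm_nonneg x₀) (hs x₀ hx₀) (by linarith)) hρμ.le

theorem nearlyFixedTimeStable (h : IsHomField G P H μ ρ f) (hΩ : IsClosed Ω)
    (hR : ∀ z ∈ Ω, R *ᵥ z ∉ Ω) (hle : ∀ z ∈ Ω, homNorm G P (R *ᵥ z) ≤ homNorm G P z)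
    (hμ : 0 < μ) : NearlyFixedTimeStable f R Ω := by
  refine ⟨h.lyapunovStable hΩ hR hle, fun r hr => ?_⟩
  obtain ⟨s, hs⟩ := h.exists_homNorm_le_imp_enorm₂_lt hr
  have hρ := h.rho_pos
  refine ⟨1 / (ρ * μ * Real.exp s ^ μ), by positivity, fun x₀ T x hx t ht htT => hs _ ?_⟩
  exact h.homNorm_le_of_entry_le hΩ hR hle hx hμ (Real.exp_pos s) ht htT

end IsHomField

/-! ### The closed-loop field of the homogeneous controller -/

section Homogeneity

variable {n m : ℕ}

/-- The curve `d(s)(e^{-cs}v)` has zero derivative. -/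
theorem dil_mulVec_of_eigenvector {G : Mat n n} {v : Vec n} {c : ℝ} (hv : G *ᵥ v = c • v) (s : ℝ) :
    dil G s *ᵥ v = Real.exp (c * s) • v := by
  have hd : ∀ s, HasDerivAt (fun s => dil G s *ᵥ (Real.exp (-(c * s)) • v)) 0 s := fun s => by
    have h1 : HasDerivWithinAt (fun s => Real.exp (-(c * s)) • v)
        ((Real.exp (-(c * s)) * -(c * 1)) • v) univ s :=
      ((((hasDerivAt_id s).const_mul c).neg.exp).smul_const v).hasDerivWithinAt
    have h2 := hasDerivWithinAt_univ.1
      (hasDerivWithinAt_dil_mulVec (G := G) (hasDerivWithinAt_id s univ) h1)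
    convert! h2 using 1
    rw [mulVec_smul, hv, ← mulVec_zero (dil G s)]
    simp only [id]
    congr 1
    module
  have h1 := is_const_of_deriv_eq_zero (fun s => (hd s).differentiableAt)
    (fun s => (hd s).deriv) s 0
  simp only [dil_zero, mul_zero, neg_zero, Real.exp_zero, one_smul, one_mulVec, mulVec_smul] at h1
  have h2 := congrArg (fun u => Real.exp (c * s) • u) h1
  simpa [smul_smul, ← Real.exp_add] using h2

/-- The commutation relation is homogeneity of degree `μ` in infinitesimal form: it makes
`d(-s)e^{-μs}M d(s)x` constant in `s`. -/
theorem mulVec_dil_mulVec {M G : Mat n n} {μ : ℝ} (hM : M * G = G * M + μ • M) (s : ℝ)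
    (x : Vec n) : M *ᵥ (dil G s *ᵥ x) = Real.exp (μ * s) • (dil G s *ᵥ (M *ᵥ x)) := by
  have hmul : ∀ {y : ℝ → Vec n} {y' : Vec n} {s : ℝ}, HasDerivAt y y' s →
      HasDerivAt (fun s => M *ᵥ y s) (M *ᵥ y') s := fun {y y' s} hy =>
    (LinearMap.toContinuousLinearMap (mulVecLin M)).hasFDerivAt.comp_hasDerivAt s hy
  have hd : ∀ s, HasDerivAt
      (fun s => dil G (-s) *ᵥ (Real.exp (-(μ * s)) • (M *ᵥ (dil G s *ᵥ x)))) 0 s := fun s => by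
    have h0 : HasDerivAt (fun s => dil G s *ᵥ x) (G *ᵥ (dil G s *ᵥ x)) s := by
      have := hasDerivWithinAt_univ.1 (hasDerivWithinAt_dil_mulVec (G := G)
        (hasDerivWithinAt_id s univ) (hasDerivWithinAt_const s univ x))
      convert! this using 1
      rw [mulVec_mulVec, ← dil_commute, ← mulVec_mulVec]
      simp
    have h1 := ((((hasDerivAt_id s).const_mul μ).neg.exp).smul
      (hmul h0)).hasDerivWithinAt (s := univ)
    have h2 := hasDerivWithinAt_univ.1
      (hasDerivWithinAt_dil_mulVec (G := G) (hasDerivWithinAt_id s univ).neg h1)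
    convert! h2 using 1
    rw [mulVec_mulVec _ M G, hM]
    simp only [id, Pi.neg_apply, Pi.smul_apply', add_mulVec, smul_mulVec, mulVec_smul,
      ← mulVec_mulVec]
    symm
    convert mulVec_zero (dil G (-s)) using 2
    module
  have h1 := is_const_of_deriv_eq_zero (fun s => (hd s).differentiableAt)
    (fun s => (hd s).deriv) s 0
  simp only [dil_zero, mul_zero, neg_zero, Real.exp_zero, one_smul, one_mulVec, mulVec_smul] at h1
  have h2 := congrArg (fun u => Real.exp (μ * s) • (dil G s *ᵥ u)) h1
  simp only [mulVec_smul, smul_smul, ← Real.exp_add, add_neg_cancel, Real.exp_zero, one_smul,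
    dil_mulVec_dil_neg_mulVec] at h2
  exact h2

/-- If `(A, B)` is controllable, then `G₀ - I` is invertible for every solution `G₀` of the
generator equations. -/
theorem isUnit_sub_one {A G₀ : Mat n n} {B : Mat n m} {Y₀ : Mat m n} (hc : Controllable A B)
    (hs : A * G₀ - G₀ * A + B * Y₀ = A) (hB : G₀ * B = 0) : IsUnit (G₀ - 1) := by
  rw [isUnit_iff_isUnit_det, isUnit_iff_ne_zero]
  intro hdet
  obtain ⟨w, hw, hw0⟩ := exists_vecMul_eq_zero_iff.2 hdet
  have hwG : w ᵥ* G₀ = w := by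
    rw [vecMul_sub, vecMul_one, sub_eq_zero] at hw0
    exact hw0
  -- If `wG₀ = w`, multiplying the Sylvester equation by `wA^k` shows inductively that `wA^k` is a
  -- left eigenvector for `k + 1`. Then `G₀B = 0` forces `wA^kB = 0`, so `w` annihilates the
  -- controllability matrix.
  have key : ∀ k : ℕ, w ᵥ* A ^ k ᵥ* G₀ = ((k : ℝ) + 1) • (w ᵥ* A ^ k) ∧ w ᵥ* A ^ k ᵥ* B = 0 := by
    intro k
    have hBk : ∀ k : ℕ, w ᵥ* A ^ k ᵥ* G₀ = ((k : ℝ) + 1) • (w ᵥ* A ^ k) →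
        w ᵥ* A ^ k ᵥ* B = 0 := fun k h => by
      have h1 := congrArg (fun u => u ᵥ* B) h
      simp only [vecMul_vecMul _ G₀, hB, vecMul_zero, smul_vecMul] at h1
      have hk : ((k : ℝ) + 1) ≠ 0 := by positivity
      exact (smul_eq_zero.1 h1.symm).resolve_left hk
    induction k with
    | zero =>
      have h0 : w ᵥ* A ^ 0 ᵥ* G₀ = (((0 : ℕ) : ℝ) + 1) • (w ᵥ* A ^ 0) := by simp [hwG]
      exact ⟨h0, hBk 0 h0⟩
    | succ k ih =>
      have h1 := congrArg (fun M => w ᵥ* A ^ k ᵥ* M) hs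
      simp only [vecMul_add, vecMul_sub, ← vecMul_vecMul, ih.1, ih.2, zero_vecMul, add_zero,
        smul_vecMul] at h1
      have h2 : w ᵥ* A ^ (k + 1) ᵥ* G₀ = (((k + 1 : ℕ) : ℝ) + 1) • (w ᵥ* A ^ (k + 1)) := by
        rw [pow_succ, ← vecMul_vecMul, sub_eq_iff_eq_add.1 h1]
        push_cast
        module
      exact ⟨h2, hBk (k + 1) h2⟩
  have hzero : w ᵥ* ctrbMatrix A B n = 0 := by
    ext p
    have := congrFun (key p.1).2 p.2
    rw [vecMul_vecMul] at this
    exact this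
  -- By full row rank `w` is itself in the range, hence orthogonal to itself.
  have htop : LinearMap.range (ctrbMatrix A B n).mulVecLin = ⊤ := by
    apply Submodule.eq_top_of_finrank_eq
    rw [Module.finrank_fin_fun]
    exact hc
  obtain ⟨u, hu⟩ := LinearMap.range_eq_top.1 htop w
  apply hw
  rw [← dotProduct_self_eq_zero]
  nth_rewrite 2 [← hu]
  rw [mulVecLin_apply, dotProduct_mulVec, hzero, zero_dotProduct]

theorem homNorm_one {P : Mat n n} (h : IsMonotone 1 P) (x : Vec n) : homNorm 1 P x = wnorm P x := by
  rcases eq_or_ne x 0 with rfl | hx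
  · simp [IsMonotone.homNorm_zero, wnorm]
  · have hq := qform_pos h.posDef hx
    have hw : 0 < wnorm P x := Real.sqrt_pos.2 hq
    rw [h.homNorm_eq_exp_of_qform (s := Real.log (wnorm P x)), Real.exp_log hw]
    rw [dil_mulVec_of_eigenvector (c := 1) (by simp), one_mul, Real.exp_neg, Real.exp_log hw,
      qform_smul, inv_pow, wnorm_eq_sqrt_qform, Real.sq_sqrt hq.le, inv_mul_cancel₀ hq.ne']

end Homogeneity

/-! ### From the design equations to a homogeneous field. -/

namespace IsDesign

variable {n m : ℕ} {A : Mat n n} {B : Mat n m} {μ ρ : ℝ} {G₀ : Mat n n} {Y₀ : Mat m n}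
  {X : Mat n n} {Y : Mat m n}

/-- Both `A₀(G₀ - I)` and `G₀A₀` equal `G₀A`, the first by the Sylvester equation and the second by
`G₀B = 0`. Thus `A₀` is homogeneous of degree `μ`. -/
theorem matA₀_mul_genD (h : IsDesign A B μ ρ G₀ Y₀ X Y) : matA₀ A B G₀ Y₀ * genD μ G₀
    = genD μ G₀ * matA₀ A B G₀ Y₀ + μ • matA₀ A B G₀ Y₀ := by
  have hU := isUnit_sub_one h.controllable h.sylvester h.generator_mul_B
  have h1 : matA₀ A B G₀ Y₀ * (G₀ - 1) = G₀ * A := by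
    rw [matA₀, gainK₀, add_mul, Matrix.mul_assoc, Matrix.mul_assoc,
      nonsing_inv_mul _ ((isUnit_iff_isUnit_det _).1 hU), Matrix.mul_one, mul_sub, mul_one]
    have := h.sylvester
    rw [sub_add_eq_add_sub, sub_eq_iff_eq_add] at this
    rw [sub_add_eq_add_sub, this]
    abel
  have h2 : G₀ * matA₀ A B G₀ Y₀ = G₀ * A := by
    rw [matA₀, mul_add, ← Matrix.mul_assoc, h.generator_mul_B, Matrix.zero_mul, add_zero]
  rw [← h2, mul_sub, mul_one, sub_eq_iff_eq_add] at h1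
  rw [genD, mul_add, mul_one, mul_smul_comm, h1, add_mul, one_mul, smul_mul_assoc, smul_add]
  abel

theorem dil_genD_mulVec_B (h : IsDesign A B μ ρ G₀ Y₀ X Y) (s : ℝ) (u : Vec m) :
    dil (genD μ G₀) s *ᵥ (B *ᵥ u) = Real.exp s • (B *ᵥ u) := by
  rw [dil_mulVec_of_eigenvector (c := 1), one_mul]
  rw [mulVec_mulVec, genD, Matrix.add_mul, Matrix.one_mul, Matrix.smul_mul,
    h.generator_mul_B, smul_zero,
    add_zero, one_smul]

theorem closedLoop_eq (x : Vec n) : closedLoop A B μ G₀ Y₀ X Y x = matA₀ A B G₀ Y₀ *ᵥ x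
    + (homNorm (genD μ G₀) X⁻¹ x) ^ (1 + μ) •
      (B *ᵥ ((Y * X⁻¹) *ᵥ homProj (genD μ G₀) X⁻¹ x)) := by
  rw [closedLoop, feedback, mulVec_add, mulVec_smul, matA₀, add_mulVec,
    ← mulVec_mulVec x, add_assoc]

/-- Congruence by `X⁻¹` carries the condition on `X` to one on `P`; `lyap_eq` treats the matrix
equation in the same way. -/
theorem isMonotone (h : IsDesign A B μ ρ G₀ Y₀ X Y) : IsMonotone (genD μ G₀) X⁻¹ := by
  have hdet := (isUnit_iff_isUnit_det _).1 h.posDef.isUnit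
  have hsymm : (X⁻¹)ᴴ = X⁻¹ := h.posDef.inv.isHermitian
  refine ⟨h.posDef.inv, ?_⟩
  have hinj : Function.Injective (X⁻¹).mulVec :=
    mulVec_injective_of_isUnit h.posDef.inv.isUnit
  have := h.monotone.conjTranspose_mul_mul_same hinj
  rw [hsymm] at this
  convert this using 1
  rw [mul_add, add_mul, mul_assoc, mul_assoc, mul_nonsing_inv _ hdet, mul_one, ← mul_assoc,
    nonsing_inv_mul _ hdet, one_mul]

theorem lyap_eq (h : IsDesign A B μ ρ G₀ Y₀ X Y) : X⁻¹ * (matA₀ A B G₀ Y₀ + B * (Y * X⁻¹))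
    + (matA₀ A B G₀ Y₀ + B * (Y * X⁻¹))ᵀ * X⁻¹
    = -(ρ • (X⁻¹ * genD μ G₀ + (genD μ G₀)ᵀ * X⁻¹)) := by
  have hdet := (isUnit_iff_isUnit_det _).1 h.posDef.isUnit
  have hsymm : (X⁻¹)ᵀ = X⁻¹ := by
    have : (X⁻¹)ᴴ = X⁻¹ := h.posDef.inv.isHermitian
    rwa [conjTranspose_eq_transpose_of_trivial] at this
  have h1 := congrArg (fun M => X⁻¹ * M * X⁻¹) h.lmi
  have hl : ∀ M : Mat n n, X⁻¹ * (M * X) * X⁻¹ = X⁻¹ * M := fun M => by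
    rw [mul_assoc, mul_assoc, mul_nonsing_inv _ hdet, mul_one]
  have hr : ∀ M : Mat n n, X⁻¹ * (X * M) * X⁻¹ = M * X⁻¹ := fun M => by
    rw [← mul_assoc, nonsing_inv_mul _ hdet, one_mul]
  simp only [mul_add, add_mul, mul_smul_comm, smul_mul_assoc, hl, hr, mul_zero, zero_mul,
    smul_add] at h1
  rw [eq_neg_iff_add_eq_zero, ← h1]
  simp only [mul_add, add_mul, transpose_add, transpose_mul, hsymm, smul_add, Matrix.mul_assoc]
  abel

theorem isHomField (h : IsDesign A B μ ρ G₀ Y₀ X Y) :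
    IsHomField (genD μ G₀) X⁻¹ (matA₀ A B G₀ Y₀ + B * (Y * X⁻¹)) μ ρ
    (closedLoop A B μ G₀ Y₀ X Y) where
  toIsMonotone := h.isMonotone
  rho_pos := h.rho_pos
  lyap := h.lyap_eq
  -- For `μ = -1` the factor `0 ^ (1 + μ)` is `1`; the field still vanishes at `0` because `homProj`
  -- does.
  map_zero := by simp [closedLoop_eq, homProj]
  map_of_homNorm := by
    intro x s hs
    rw [closedLoop_eq, homProj, hs, Real.log_exp]
    set y := dil (genD μ G₀) (-s) *ᵥ x with hy
    have hx : x = dil (genD μ G₀) s *ᵥ y := (dil_mulVec_dil_neg_mulVec _ s x).symm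
    rw [add_mulVec, mulVec_add, ← mulVec_mulVec y B, h.dil_genD_mulVec_B, smul_add, smul_smul,
      ← mulVec_dil_mulVec h.matA₀_mul_genD, ← hx, ← Real.exp_mul, ← Real.exp_add]
    congr 3
    ring
  bounded := by
    intro s
    obtain ⟨r, -, hr⟩ := h.isMonotone.exists_homNorm_le_imp_norm_le_const s
    obtain ⟨r', hr'0, hr'⟩ := h.isMonotone.exists_homNorm_le_imp_norm_le_const 0
    -- The bound `μ ≥ -1` keeps `‖x‖_d^{1+μ}` bounded near the origin.
    have hμ : 0 ≤ 1 + μ := by linarith [h.degree.1]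
    have hcont : Continuous fun p : ℝ × Vec n × Vec n => matA₀ A B G₀ Y₀ *ᵥ p.2.1
        + p.1 • (B *ᵥ ((Y * X⁻¹) *ᵥ p.2.2)) := by
      refine (continuous_const.matrix_mulVec continuous_snd.fst).add (continuous_fst.smul ?_)
      exact continuous_const.matrix_mulVec (continuous_const.matrix_mulVec continuous_snd.snd)
    have hK : IsCompact (Icc 0 (Real.exp s ^ (1 + μ)) ×ˢ
        (Metric.closedBall (0 : Vec n) r ×ˢ Metric.closedBall (0 : Vec n) r')) :=
      isCompact_Icc.prod ((isCompact_closedBall _ _).prod (isCompact_closedBall _ _))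
    obtain ⟨M, -, hM⟩ := (hK.image hcont).isBounded.exists_pos_norm_le
    refine ⟨M, fun x hx => hM _ ⟨(homNorm (genD μ G₀) X⁻¹ x ^ (1 + μ), x,
      homProj (genD μ G₀) X⁻¹ x), ⟨⟨?_, ?_⟩, ?_, ?_⟩, (closedLoop_eq x).symm⟩⟩
    · exact Real.rpow_nonneg (IsMonotone.homNorm_nonneg x) _
    · exact Real.rpow_le_rpow (IsMonotone.homNorm_nonneg x) hx hμ
    · exact mem_closedBall_zero_iff.2 (hr x hx)
    · refine mem_closedBall_zero_iff.2 ?_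
      rcases eq_or_ne x 0 with rfl | hx0
      · simpa [homProj] using hr'0.le
      · refine hr' _ (h.isMonotone.homNorm_le_exp_iff.2 ?_)
        rw [neg_zero, dil_zero, one_mulVec]
        exact (h.isMonotone.qform_dil_log_homNorm hx0).le

variable {R : Mat n n} {Ω : Set (Vec n)}

/-- With `s = ln ‖z‖_d`, commutation gives `d(-s)Rz = Ry` for the projection `y` of `z`, and (b)
puts `Ry` in the unit `P`-ball. -/
theorem homNorm_mulVec_le (h : IsDesign A B μ ρ G₀ Y₀ X Y) (hR : ∀ z ∈ Ω, R *ᵥ z ∉ Ω)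
    (hcomm : ∀ x ∈ Ω,
      dil (genD μ G₀) (-Real.log (homNorm (genD μ G₀) X⁻¹ x)) *ᵥ (R *ᵥ x) =
        R *ᵥ (dil (genD μ G₀) (-Real.log (homNorm (genD μ G₀) X⁻¹ x)) *ᵥ x))
    (hjump : ∀ y ∈ homProj (genD μ G₀) X⁻¹ '' Ω, y ⬝ᵥ ((Rᵀ * X⁻¹ * R) *ᵥ y) ≤ 1)
    {z : Vec n} (hz : z ∈ Ω) :
    homNorm (genD μ G₀) X⁻¹ (R *ᵥ z) ≤ homNorm (genD μ G₀) X⁻¹ z := by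
  -- The origin is fixed by `R`, so it cannot lie in `Ω`.
  have hz0 : z ≠ 0 := by
    rintro rfl
    exact hR 0 hz (by rwa [mulVec_zero])
  have hN := IsMonotone.homNorm_pos (G := genD μ G₀) (P := X⁻¹) hz0
  rw [← Real.exp_log hN, h.isMonotone.homNorm_le_exp_iff, hcomm z hz]
  have h1 := hjump _ ⟨z, hz, rfl⟩
  rw [homProj, mul_assoc, ← mulVec_mulVec, dotProduct_mulVec, vecMul_transpose,
    ← mulVec_mulVec] at h1
  exact h1

/-- For `μ = 0` the dilation is `e^s I` and the homogeneous norm is the `P`-norm, so decay transfers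
to the Euclidean norm by equivalence of norms. -/
theorem exponentiallyStable (h : IsDesign A B μ ρ G₀ Y₀ X Y)
    (hμ : μ = 0) (hΩ : IsClosed Ω) (hR : ∀ z ∈ Ω, R *ᵥ z ∉ Ω)
    (hle : ∀ z ∈ Ω, homNorm (genD μ G₀) X⁻¹ (R *ᵥ z) ≤ homNorm (genD μ G₀) X⁻¹ z) :
    ExponentiallyStable (closedLoop A B μ G₀ Y₀ X Y) R Ω := by
  have hG : genD μ G₀ = 1 := by rw [genD, hμ, zero_smul, add_zero]
  have hmono := h.isMonotone
  have hcomp : ∀ {S Q : Mat n n}, Q.PosDef → ∃ C > 0, ∀ x, √(qform S x) ≤ C * √(qform Q x) :=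
    fun {S Q} hQ => by
      obtain ⟨C, hC, hCle⟩ := exists_qform_le_mul_qform hQ S
      refine ⟨√C, Real.sqrt_pos.2 hC, fun x => ?_⟩
      rw [← Real.sqrt_mul hC.le]
      exact Real.sqrt_le_sqrt (hCle x)
  obtain ⟨C₁, hC₁, h1⟩ := hcomp (S := 1) hmono.posDef
  obtain ⟨C₂, hC₂, h2⟩ := hcomp (S := X⁻¹) (Q := 1) PosDef.one
  refine ⟨C₁ * C₂, mul_pos hC₁ hC₂, ρ, h.rho_pos, fun x₀ T x hx t ht htT => ?_⟩
  have hdecay := h.isHomField.homNorm_le_exp_mul hΩ hR hle hx hμ ht htT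
  rw [hG] at hmono hdecay
  rw [homNorm_one hmono, homNorm_one hmono, wnorm_eq_sqrt_qform, wnorm_eq_sqrt_qform] at hdecay
  rw [enorm₂_eq_sqrt_qform, enorm₂_eq_sqrt_qform]
  calc √(qform 1 (x t)) ≤ C₁ * √(qform X⁻¹ (x t)) := h1 _
    _ ≤ C₁ * (Real.exp (-ρ * t) * (C₂ * √(qform 1 x₀))) := by
      gcongr
      exact hdecay.trans (mul_le_mul_of_nonneg_left (h2 _) (Real.exp_pos _).le)
    _ = C₁ * C₂ * Real.exp (-ρ * t) * √(qform 1 x₀) := by ring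

end IsDesign

end HomImpulsive

end

open HomImpulsive in
theorem theorem4 {n m : ℕ} (A : Mat n n) (B : Mat n m) (μ ρ : ℝ)
    (G₀ : Mat n n) (Y₀ : Mat m n) (X : Mat n n) (Y : Mat m n)
    (hdesign : IsDesign A B μ ρ G₀ Y₀ X Y)
    (R : Mat n n) (Ω : Set (Vec n)) (hΩ : IsClosed Ω)
    (hRΩ : (fun x => R *ᵥ x) '' Ω ∩ Ω = ∅)
    (hcomm : ∀ x ∈ Ω,
      dil (genD μ G₀) (-Real.log (homNorm (genD μ G₀) X⁻¹ x)) *ᵥ (R *ᵥ x) =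
        R *ᵥ (dil (genD μ G₀) (-Real.log (homNorm (genD μ G₀) X⁻¹ x)) *ᵥ x))
    (hjump : ∀ y ∈ homProj (genD μ G₀) X⁻¹ '' Ω, y ⬝ᵥ ((Rᵀ * X⁻¹ * R) *ᵥ y) ≤ 1) :
    ForwardComplete (closedLoop A B μ G₀ Y₀ X Y) R Ω ∧
    (μ < 0 →
      FiniteTimeStable (closedLoop A B μ G₀ Y₀ X Y) R Ω ∧
      ∀ x₀ T x, IsSolution (closedLoop A B μ G₀ Y₀ X Y) R Ω x₀ T x →
        ∀ t : ℝ, (homNorm (genD μ G₀) X⁻¹ x₀) ^ (-μ) / (-(ρ * μ)) ≤ t → (t : EReal) < T →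
          x t = 0) ∧
    (μ = 0 →
      ExponentiallyStable (closedLoop A B μ G₀ Y₀ X Y) R Ω ∧
      ∀ x₀ T x, IsSolution (closedLoop A B μ G₀ Y₀ X Y) R Ω x₀ T x →
        ∀ t : ℝ, 0 ≤ t → (t : EReal) < T →
          homNorm (genD μ G₀) X⁻¹ (x t) ≤ Real.exp (-ρ * t) * homNorm (genD μ G₀) X⁻¹ x₀) ∧
    (0 < μ →
      NearlyFixedTimeStable (closedLoop A B μ G₀ Y₀ X Y) R Ω ∧
      ∀ x₀ T x, IsSolution (closedLoop A B μ G₀ Y₀ X Y) R Ω x₀ T x →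
        ∀ r : ℝ, 0 < r → ∀ t : ℝ, 1 / (ρ * μ * r ^ μ) ≤ t → (t : EReal) < T →
          homNorm (genD μ G₀) X⁻¹ (x t) ≤ r) := by

  have hR : ∀ z ∈ Ω, R *ᵥ z ∉ Ω := fun z hz hRz =>
    (hRΩ ▸ ⟨⟨z, hz, rfl⟩, hRz⟩ : R *ᵥ z ∈ (∅ : Set (Vec n)))
  have hf := hdesign.isHomField
  have hle := fun z hz => hdesign.homNorm_mulVec_le hR hcomm hjump (z := z) hz
  refine ⟨hf.forwardComplete hΩ hR hle, fun hμ => ⟨hf.finiteTimeStable hΩ hR hle hμ, ?_⟩,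
    fun hμ => ⟨hdesign.exponentiallyStable hμ hΩ hR hle, ?_⟩,
    fun hμ => ⟨hf.nearlyFixedTimeStable hΩ hR hle hμ, ?_⟩⟩
  · exact fun x₀ T x hx t ht htT => hf.eq_zero_of_settling_le hΩ hR hle hx hμ ht htT
  · exact fun x₀ T x hx t ht htT => hf.homNorm_le_exp_mul hΩ hR hle hx hμ ht htT
  · exact fun x₀ T x hx r hr t ht htT => hf.homNorm_le_of_entry_le hΩ hR hle hx hμ hr ht htT
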